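/- **Setting.** Consider $$x_\star=\arg\min_{x\in\mathbb R^d} f(x)+h(x)\quad\text{s.t. } g_j(x)\le 0,\ 1\le j\le m,\qquad f(x)=\mathbb E_\xi[f_\xi(x)].$$ Let $\mathcal X_j=\{g_j\le 0\}$, $\mathcal X=\bigcap_j\mathcal X_j$, $\kappa_f=L_f/\mu$, $[a]_+=\max(a,0)$, and for $\lambda>0$ let $\mathrm{prox}_{\lambda\varphi}(z)=\arg\min_u \frac1{2\lambda}\|u-z\|^2+\varphi(u)$. Let $r,\nu>0$, $L_g\ge0$, $0<\mu\le L_f$, and let $B_x,B_\star,\sigma_\star,G_\star,\tilde B$ be real numbers. Assume: 1. every $f_\xi$ and $g_j$ is a real-valued convex function, differentiable with $L_f$- resp. $L_g$-Lipschitz gradient; $h:\mathbb R^d\to(-\infty,+\infty]$ is proper, closed and convex; 2. (Slater) there is $\tilde x$ with $g_j(\tilde x)\le-\nu$ for all $j$ and $f(\tilde x)+h(\tilde x)-f(x_\star)-h(x_\star)\le\tilde B$; 3. $f$ is $\mu$-strongly convex; 4. $\mathbb E\|\nabla f_\xi(x_\star)-\nabla f(x_\star)\|^2\le\sigma_\star^2$;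 5. $\frac1m\sum_j\|\nabla g_j(x_\star)\|^2\le G_\star^2$, and $\|\nabla f(x_\star)\|^2+\|v\|^2\le B_\star$ for some $v\in\partial h(x_\star)$; 6. (linear regularity) $r\,\mathrm{dist}(x,\mathcal X)^2\le\frac1m\sum_j\mathrm{dist}(x,\mathcal X_j)^2$ for all $x\in\mathbb R^d$. **Algorithm (nested HPS).** Start from $x_1$ with $\|x_1-x_\star\|\le B_x$. For $t=1,2,\dots$ draw $i_t$ (distributed as $\xi$) and $j_t$ (uniform on $\{1,\dots,m\}$), independently of the draws at all other times; with $\eta_t=\frac{2(\mu+L_f)}{\mu L_f t+8(\mu+L_f)^2}$ put $$z_t=x_t-\eta_t\nabla f_{i_t}(x_t),\quad \gamma_t=\frac{\|z_t-\tilde x\|^2}{2\eta_t\nu},\quad \beta_t=\frac{2\nu}{2\nu+L_g\|z_t-\tilde x\|^2},$$ $$\tau_t=\Big\lceil\tfrac12\log\big((t+32)(1+\kappa_f)\big)\Big(1+\tfrac{L_g}{2\nu}\|z_t-\tilde x\|^2\Big)\Big\rceil .$$ Let $u_1=x_t$ and, for $s=1,\dots,\tau_t$, $u_{s+1}=\mathrm{prox}_{\beta_t\eta_t\tilde\phi_s}\big((1-\beta_t)u_s+\beta_tz_t\big)$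 with $\tilde\phi_s(u)=h(u)+\gamma_t[g_{j_t}(u_s)+\langle\nabla g_{j_t}(u_s),u-u_s\rangle]_+$; finally let $x_{t+1}=u_{\tau_t+1}$. One stochastic first-order oracle (SFO) call is made per inner step, so that computing $x_T$ costs $N_T=\sum_{t=1}^{T-1}\tau_t$ calls. **Theorem.** There are constants $C,C'>0$ depending only on $r,B_\star,\sigma_\star,G_\star,\tilde B,\nu,L_g,B_x$, and $C''>0$ depending on these and on $\mu$ (so none of them depends on $m$, $d$, $L_f$ or the number of functions $f_\xi$), such that: * for all $T\ge1$, $\displaystyle\mathbb E\|x_T-x_\star\|^2\le C\Big(\frac1{\mu^2T}+\frac{\kappa_f^2}{T^2}\Big)$; * for all $t\ge1$, $\mathbb E\,\tau_t\le C''\log\big((1+\kappa_f)(t+1)\big)$, that is, $\mathbb E\,\tau_t=O(\log t)$; * for all $0<\varepsilon\le\frac12$ and $T=\big\lceil C'\big(\frac1{\mu^2\varepsilon}+\frac{\kappa_f}{\sqrt\varepsilon}\big)\big\rceil$, one has $\mathbb E\|x_T-x_\star\|^2\le\varepsilon$, and the expected number of SFO calls satisfies $$\mathbb E\,N_T\le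 C''\Big(\frac1\varepsilon+\frac{\kappa_f}{\sqrt\varepsilon}\Big)\Big(\log\frac1\varepsilon+\log(1+\kappa_f)\Big);$$ in particular, if $\varepsilon\le 1/(1+\kappa_f)$, then $\mathbb E\,N_T\le C''\big(\frac1\varepsilon+\frac{\kappa_f}{\sqrt\varepsilon}\big)\log\frac1\varepsilon$. -/

import Mathlib

open MeasureTheory ProbabilityTheory

namespace NHPS

/-- The Euclidean space `ℝ^d`. -/
abbrev E (d : ℕ) : Type := EuclideanSpace ℝ (Fin d)

/-- The functions of the problem: minimise `𝔼 f_ξ(x) + h(x)` subject to `g_j(x) ≤ 0` for all `j`.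
The regulariser `h` is extended-real valued, so that it may contain indicator functions. -/
structure Problem (d m : ℕ) (Ξ : Type*) where
  f : Ξ → E d → ℝ
  g : Fin m → E d → ℝ
  h : E d → EReal

/-- The scalars that the algorithm uses: strong convexity constant `μ`, smoothness constants
`Lf`, `Lg`, and the Slater margin `ν`. -/
structure Params where
  μ : ℝ
  Lf : ℝ
  Lg : ℝ
  ν : ℝ

/-- The objective condition number. -/
noncomputable def Params.κ (p : Params) : ℝ := p.Lf / p.μ

/-- `φ` is differentiable with `L`-Lipschitz gradient. -/
def IsSmoothFun {d : ℕ} (L : ℝ) (φ : E d → ℝ) : Prop :=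
  Differentiable ℝ φ ∧ ∀ x y, ‖gradient φ x - gradient φ y‖ ≤ L * ‖x - y‖

/-- Proper, closed (lower semicontinuous) and convex (convex epigraph). -/
structure IsProperClosedConvex {d : ℕ} (h : E d → EReal) : Prop where
  ne_bot : ∀ x, h x ≠ ⊥
  exists_ne_top : ∃ x, h x ≠ ⊤
  closed : LowerSemicontinuous h
  convex : Convex ℝ {q : E d × ℝ | h q.1 ≤ (q.2 : EReal)}

/-- The convex subdifferential. For proper `h` it is empty outside the domain of `h`. -/
def subdifferential {d : ℕ} (h : E d → EReal) (x : E d) : Set (E d) :=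
  {v | ∀ y, h x + ((inner ℝ v (y - x) : ℝ) : EReal) ≤ h y}

namespace Problem

variable {d m : ℕ} {Ξ : Type*}

/-- The smooth part of the objective, `F(x) = 𝔼 f_ξ(x)`. -/
noncomputable def mean [MeasurableSpace Ξ] (Q : Problem d m Ξ) (P : Measure Ξ) (x : E d) : ℝ :=
  ∫ ξ, Q.f ξ x ∂P

/-- The full objective. -/
noncomputable def objective [MeasurableSpace Ξ] (Q : Problem d m Ξ) (P : Measure Ξ)
    (x : E d) : EReal :=
  (Q.mean P x : EReal) + Q.h x

/-- The set cut out by the `j`-th constraint. -/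
def constraintSet (Q : Problem d m Ξ) (j : Fin m) : Set (E d) := {x | Q.g j x ≤ 0}

/-- The set cut out by all constraints. -/
def feasibleSet (Q : Problem d m Ξ) : Set (E d) := ⋂ j, Q.constraintSet j

/-- The expectation defining the objective makes sense. -/
def IsStochastic [MeasurableSpace Ξ] (Q : Problem d m Ξ) (P : Measure Ξ) : Prop :=
  ∀ x, Measurable (fun ξ => Q.f ξ x) ∧ Integrable (fun ξ => Q.f ξ x) P

/-- Convexity and smoothness of all functions. -/
structure ConvexSmooth (Q : Problem d m Ξ) (p : Params) : Prop where
  f_convex : ∀ ξ, ConvexOn ℝ Set.univ (Q.f ξ)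
  f_smooth : ∀ ξ, IsSmoothFun p.Lf (Q.f ξ)
  g_convex : ∀ j, ConvexOn ℝ Set.univ (Q.g j)
  g_smooth : ∀ j, IsSmoothFun p.Lg (Q.g j)
  h_pcc : IsProperClosedConvex Q.h

/-- `xs` solves the constrained problem. -/
def IsSolution [MeasurableSpace Ξ] (Q : Problem d m Ξ) (P : Measure Ξ) (xs : E d) : Prop :=
  xs ∈ Q.feasibleSet ∧ ∀ x ∈ Q.feasibleSet, Q.objective P xs ≤ Q.objective P x

/-- Slater's condition at `xt` with margin `ν`, with optimality gap at most `Bt`. -/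
def Slater [MeasurableSpace Ξ] (Q : Problem d m Ξ) (P : Measure Ξ) (ν Bt : ℝ)
    (xs xt : E d) : Prop :=
  (∀ j, Q.g j xt ≤ -ν) ∧ Q.objective P xt ≤ Q.objective P xs + (Bt : EReal)

/-- Bounded variance of the stochastic gradients at the solution. -/
def BoundedVariance [MeasurableSpace Ξ] (Q : Problem d m Ξ) (P : Measure Ξ) (σ : ℝ)
    (xs : E d) : Prop :=
  Integrable (fun ξ => ‖gradient (Q.f ξ) xs - gradient (Q.mean P) xs‖ ^ 2) P ∧
    ∫ ξ, ‖gradient (Q.f ξ) xs - gradient (Q.mean P) xs‖ ^ 2 ∂P ≤ σ ^ 2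

/-- Bounds on the gradients at the solution. -/
def BoundedGradients [MeasurableSpace Ξ] (Q : Problem d m Ξ) (P : Measure Ξ) (G B : ℝ)
    (xs : E d) : Prop :=
  (∑ j, ‖gradient (Q.g j) xs‖ ^ 2) / m ≤ G ^ 2 ∧
    ∃ v ∈ subdifferential Q.h xs, ‖gradient (Q.mean P) xs‖ ^ 2 + ‖v‖ ^ 2 ≤ B

/-- Linear regularity: the mean-squared distance to the single constraint sets controls the
squared distance to the feasible set. -/
def LinearlyRegular (Q : Problem d m Ξ) (r : ℝ) : Prop :=
  ∀ x, r * Metric.infDist x Q.feasibleSet ^ 2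
    ≤ (∑ j, Metric.infDist x (Q.constraintSet j) ^ 2) / m

end Problem

/-- The proximal point: the minimiser of `‖u - z‖² / (2 lam) + φ u`. -/
noncomputable def prox {d : ℕ} (lam : ℝ) (φ : E d → EReal) (z : E d) : E d :=
  Classical.epsilon fun u =>
    IsMinOn (fun u => ((‖u - z‖ ^ 2 / (2 * lam) : ℝ) : EReal) + φ u) Set.univ u

/-- The partially linearised penalty `h(u) + γ [g(w) + ⟨∇g(w), u - w⟩]₊`. -/
noncomputable def linPenalty {d : ℕ} (h : E d → EReal) (g : E d → ℝ) (γ : ℝ) (w u : E d) : EReal :=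
  h u + ((γ * max (g w + inner ℝ (gradient g w) (u - w)) 0 : ℝ) : EReal)

namespace Params

variable {d : ℕ}

/-- The step size `η_t`. -/
noncomputable def η (p : Params) (t : ℕ) : ℝ :=
  2 * (p.μ + p.Lf) / (p.μ * p.Lf * t + 8 * (p.μ + p.Lf) ^ 2)

/-- The adaptive penalty `γ_t`. -/
noncomputable def γ (p : Params) (xt : E d) (t : ℕ) (z : E d) : ℝ :=
  ‖z - xt‖ ^ 2 / (2 * p.η t * p.ν)

/-- The relative inner step size `β_t`. -/
noncomputable def β (p : Params) (xt z : E d) : ℝ :=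
  2 * p.ν / (2 * p.ν + p.Lg * ‖z - xt‖ ^ 2)

/-- The length `τ_t` of the inner loop. -/
noncomputable def τ (p : Params) (xt : E d) (t : ℕ) (z : E d) : ℕ :=
  ⌈1 / 2 * Real.log ((t + 32) * (1 + p.κ)) * (1 + p.Lg / (2 * p.ν) * ‖z - xt‖ ^ 2)⌉₊

end Params

section Algorithm

variable {d m : ℕ} {Ξ : Type*}

/-- The stochastic gradient step `z_t = x_t - η_t ∇f_ξ(x_t)`. -/
noncomputable def gradStep (Q : Problem d m Ξ) (p : Params) (t : ℕ) (ξ : Ξ) (x : E d) : E d :=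
  x - p.η t • gradient (Q.f ξ) x

/-- One inner step `u_s ↦ u_{s+1}`. -/
noncomputable def innerStep (Q : Problem d m Ξ) (p : Params) (xt : E d) (t : ℕ) (j : Fin m)
    (z u : E d) : E d :=
  prox (p.β xt z * p.η t) (linPenalty Q.h (Q.g j) (p.γ xt t z) u)
    ((1 - p.β xt z) • u + p.β xt z • z)

/-- One outer step: a stochastic gradient step, then `τ_t` inner steps started at `x_t`. -/
noncomputable def outerStep (Q : Problem d m Ξ) (p : Params) (xt : E d) (t : ℕ) (ξ : Ξ)
    (j : Fin m) (x : E d) : E d :=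
  (innerStep Q p xt t j (gradStep Q p t ξ x))^[p.τ xt t (gradStep Q p t ξ x)] x

/-- The iterates `x_t` for given sample sequences; numbering starts at `1` (the value at `0` is
unused). -/
noncomputable def iter (Q : Problem d m Ξ) (p : Params) (xt x₁ : E d) (i : ℕ → Ξ)
    (j : ℕ → Fin m) : ℕ → E d
  | 0 => x₁
  | 1 => x₁
  | t + 2 => outerStep Q p xt (t + 1) (i (t + 1)) (j (t + 1)) (iter Q p xt x₁ i j (t + 1))

/-- The number of inner steps made in outer iteration `t`. -/
noncomputable def innerLength (Q : Problem d m Ξ) (p : Params) (xt x₁ : E d) (i : ℕ → Ξ)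
    (j : ℕ → Fin m) (t : ℕ) : ℕ :=
  p.τ xt t (gradStep Q p t (i t) (iter Q p xt x₁ i j t))

/-- The number of oracle calls made to compute `x_T`: one for each inner step (the call at
`u_1 = x_t` also returns the objective gradient at `x_t`). -/
noncomputable def sfoCalls (Q : Problem d m Ξ) (p : Params) (xt x₁ : E d) (i : ℕ → Ξ)
    (j : ℕ → Fin m) (T : ℕ) : ℕ :=
  ∑ t ∈ Finset.Ico 1 T, innerLength Q p xt x₁ i j t

end Algorithm

/-- The pairs `(i_t, j_t)` are independent over `t`, each `i_t` has law `P`, and each `j_t` is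
uniform. (Nothing is required of the dependence between `i_t` and `j_t` for the same `t`.) -/
structure IsSampling {m : ℕ} {Ξ Ω : Type*} [MeasurableSpace Ξ] [MeasurableSpace Ω]
    (P : Measure Ξ) (Pr : Measure Ω) (i : ℕ → Ω → Ξ) (j : ℕ → Ω → Fin m) : Prop where
  measurable_i : ∀ t, Measurable (i t)
  measurable_j : ∀ t, Measurable (j t)
  indep : iIndepFun (fun t ω => (i t ω, j t ω)) Pr
  law_i : ∀ t, Pr.map (i t) = P
  law_j : ∀ t k, Pr {ω | j t ω = k} = (m : ENNReal)⁻¹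

end NHPS

namespace NHPS

/-! The core is the recursion E‖x_{t+1} - x⋆‖² ≤ (1 - aη_t) E‖x_t - x⋆‖² + Cη_t², where a = μL_f/(μ
+ L_f) and C (`noiseLevel`) involves neither m nor L_f. Since η_t = 2/(a(t + t₀)) with t₀ ≤ 32κ,
`recursion_bound` turns it into the rate. Noise of order η² rests on three facts.

Exact penalty (`neg_penalty_le_linGap`). Outside the feasible set X the linearised objective falls
below its value at x⋆ by at most S·dist(·, X), with S independent of m. Moving a point towards the
Slater point repairs every constraint whose gradient at x⋆ is moderate; the others are rare in mean
square because of G⋆, so linear regularity halves the distance to X. Hence a slope M improves to M/2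
+ S/2. A crude slope depending on m starts the iteration and is halved away.

Inner loop (`innerStep_spec`, `infDist_sq_le`, `value_gap_le`). The step β is such that the
curvature error of linearising g_j is absorbed by the proximity term, so each inner step contracts
towards x⋆ by 1 - β up to a value gap. The penalty γ is such that ‖u - z‖² + 2ηγ[g_j(u)]₊ ≥ dist(z,
X_j)². Averaging over j and linear regularity give a gain of order dist(x, X)², which beats the loss
2ηS·dist(x, X) up to O(η²).

Length of the inner loop (`outerStep_le`). After τ steps the residual weight q = (1 - β)^τ
multiplies a noise term that is centred, but q depends on the same sample, so the product does not
average out. The logarithm in τ makes 2q² ≤ aη, and then Young's inequality suffices.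

For the cost, 1/β grows with ‖z_t - x̃‖², whose mean is bounded uniformly in t and L_f
(`integral_error_le_const`, `norm_gradStep_sub_sq_le`); hence E τ_t is logarithmic. Much of the
remaining work is measurability: the proximal step is continuous in its data, so iterates are
measurable and x_t is independent of the draws at time t. -/

/-- Letting `s → 0+` in an affine bound. -/
theorem le_of_forall_le_add_mul {a b c : ℝ} (hab : ∀ s : ℝ, 0 < s → s < 1 → a ≤ b + s * c) :
    a ≤ b := by
  have h1 : Filter.Tendsto (fun s : ℝ => b + s * c) (nhdsWithin 0 (Set.Ioi 0)) (nhds b) := by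
    have : Filter.Tendsto (fun s : ℝ => b + s * c) (nhds 0) (nhds (b + 0 * c)) := by
      apply Continuous.tendsto; fun_prop
    simpa using this.mono_left nhdsWithin_le_nhds
  refine ge_of_tendsto h1 ?_
  filter_upwards [Ioo_mem_nhdsGT (zero_lt_one' ℝ)] with s hs
  exact hab s hs.1 hs.2

/-! ### Gradient inequalities for smooth, convex and strongly convex functions. -/

section Smooth

variable {d : ℕ} {φ : E d → ℝ} {L : ℝ}

/-- Derivative of a function along a segment. -/
theorem hasDerivAt_comp_line (hφ : Differentiable ℝ φ) (x v : E d) (s : ℝ) :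
    HasDerivAt (fun s : ℝ => φ (x + s • v)) (inner ℝ (gradient φ (x + s • v)) v) s := by
  have h1 := (hφ (x + s • v)).hasGradientAt.hasFDerivAt
  have h2 : HasDerivAt (fun s : ℝ => x + s • v) v s := by
    simpa using ((hasDerivAt_id s).smul_const v).const_add x
  exact (h1.comp_hasDerivAt s h2).congr_deriv (InnerProductSpace.toDual_apply_apply)

/-- First-order Taylor bound for functions with Lipschitz gradient. -/
theorem IsSmoothFun.abs_sub_le (hφ : IsSmoothFun L φ) (x y : E d) :
    |φ y - φ x - inner ℝ (gradient φ x) (y - x)| ≤ L / 2 * ‖y - x‖ ^ 2 := by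
  set v := y - x with hv
  let ψ : ℝ → ℝ := fun s => φ (x + s • v) - φ x - s * inner ℝ (gradient φ x) v
  have hψ : ∀ s, HasDerivAt ψ
      (inner ℝ (gradient φ (x + s • v)) v - inner ℝ (gradient φ x) v) s := by
    intro s
    exact (((hasDerivAt_comp_line hφ.1 x v s).sub_const (φ x)).sub
      ((hasDerivAt_id s).mul_const (inner ℝ (gradient φ x) v))).congr_deriv (by rw [one_mul])
  have hB : ∀ s : ℝ, HasDerivAt (fun s : ℝ => L / 2 * ‖v‖ ^ 2 * s ^ 2) (L * ‖v‖ ^ 2 * s) s := by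
    intro s
    refine ((hasDerivAt_pow 2 s).const_mul (L / 2 * ‖v‖ ^ 2)).congr_deriv ?_
    push_cast
    ring
  -- Comparison of derivatives on [0, 1]: the remainder ψ starts at 0 and its derivative is bounded
  -- by that of the quadratic.
  have := image_norm_le_of_norm_deriv_right_le_deriv_boundary (f := ψ) (a := 0) (b := 1)
    (fun s _ => (hψ s).continuousAt.continuousWithinAt)
    (fun s _ => (hψ s).hasDerivWithinAt) (B := fun s : ℝ => L / 2 * ‖v‖ ^ 2 * s ^ 2)
    (by simp [ψ]) (fun s => hB s)
    (fun s hs => by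
      rw [← inner_sub_left]
      calc ‖(inner ℝ (gradient φ (x + s • v) - gradient φ x) v : ℝ)‖
          ≤ ‖gradient φ (x + s • v) - gradient φ x‖ * ‖v‖ := norm_inner_le_norm _ _
        _ ≤ (L * ‖x + s • v - x‖) * ‖v‖ := by gcongr; exact hφ.2 _ _
        _ = L * ‖v‖ ^ 2 * s := by
            rw [add_sub_cancel_left, norm_smul, Real.norm_of_nonneg hs.1]; ring)
    (Set.right_mem_Icc.2 zero_le_one)
  simpa [ψ, hv, Real.norm_eq_abs] using this

theorem IsSmoothFun.le_add (hφ : IsSmoothFun L φ) (x y : E d) :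
    φ y ≤ φ x + inner ℝ (gradient φ x) (y - x) + L / 2 * ‖y - x‖ ^ 2 := by
  linarith [(abs_le.1 (hφ.abs_sub_le x y)).2]

/-- The gradient inequality of a convex function. -/
theorem add_inner_gradient_le (hc : ConvexOn ℝ Set.univ φ) (hφ : Differentiable ℝ φ) (x y : E d) :
    φ x + inner ℝ (gradient φ x) (y - x) ≤ φ y := by
  have hconv : ConvexOn ℝ Set.univ (fun s : ℝ => φ (x + s • (y - x))) := by
    refine ⟨convex_univ, fun s _ t _ a b ha hb hab => ?_⟩
    have := hc.2 (Set.mem_univ (x + s • (y - x))) (Set.mem_univ (x + t • (y - x))) ha hb hab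
    refine le_of_eq_of_le ?_ this
    rw [smul_add, smul_add, add_add_add_comm, ← add_smul, hab, one_smul, smul_smul, smul_smul,
      ← add_smul]
    simp
  have h0 := hasDerivAt_comp_line hφ x (y - x) 0
  have := hconv.le_slope_of_hasDerivAt (Set.mem_univ 0) (Set.mem_univ 1) zero_lt_one h0
  simp [slope_def_field] at this
  simpa using by linarith

/-- The gradient inequality of a smooth convex function, with the gradient gap. -/
theorem add_inner_gradient_add_le (hc : ConvexOn ℝ Set.univ φ) (hφ : IsSmoothFun L φ)
    (hL : 0 < L) (x y : E d) :
    φ x + inner ℝ (gradient φ x) (y - x) + ‖gradient φ y - gradient φ x‖ ^ 2 / (2 * L) ≤ φ y := by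
  set w := gradient φ y - gradient φ x with hw
  -- `u` minimises the quadratic upper model at `y` minus the linear lower model at `x`; comparing
  -- both models there leaves exactly ‖w‖²/(2L).
  set u := y - (1 / L) • w with hu
  have h1 := add_inner_gradient_le hc hφ.1 x u
  have h2 := hφ.le_add y u
  have e1 : u - y = -((1 / L) • w) := by rw [hu]; abel
  have e2 : u - x = (y - x) - (1 / L) • w := by rw [hu]; abel
  rw [e1, norm_neg, norm_smul, Real.norm_of_nonneg (by positivity), inner_neg_right,
    inner_smul_right] at h2
  rw [e2, inner_sub_right, inner_smul_right] at h1
  have h3 : (inner ℝ (gradient φ y) w : ℝ) - inner ℝ (gradient φ x) w = ‖w‖ ^ 2 := by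
    rw [← inner_sub_left, ← hw, real_inner_self_eq_norm_sq]
  have h4 : L / 2 * (1 / L * ‖w‖) ^ 2 = ‖w‖ ^ 2 / (2 * L) := by field_simp
  have h5 : 1 / L * (inner ℝ (gradient φ y) w : ℝ) - 1 / L * inner ℝ (gradient φ x) w
      = 2 * (‖w‖ ^ 2 / (2 * L)) := by
    rw [← mul_sub, h3]; field_simp
  linarith

/-- Cocoercivity of the gradient of a smooth convex function. -/
theorem norm_gradient_sub_sq_le (hc : ConvexOn ℝ Set.univ φ) (hφ : IsSmoothFun L φ)
    (hL : 0 < L) (x y : E d) :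
    ‖gradient φ x - gradient φ y‖ ^ 2 ≤ L * inner ℝ (gradient φ x - gradient φ y) (x - y) := by
  have h1 := add_inner_gradient_add_le hc hφ hL x y
  have h2 := add_inner_gradient_add_le hc hφ hL y x
  rw [norm_sub_rev] at h1
  have e : y - x = -(x - y) := by abel
  rw [e, inner_neg_right] at h1
  have h3 : ‖gradient φ x - gradient φ y‖ ^ 2 / L
      ≤ inner ℝ (gradient φ x - gradient φ y) (x - y) := by
    rw [inner_sub_left]
    have : ‖gradient φ x - gradient φ y‖ ^ 2 / L
      = 2 * (‖gradient φ x - gradient φ y‖ ^ 2 / (2 * L)) := by field_simp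
    linarith
  rw [div_le_iff₀ hL] at h3
  linarith

/-- The gradient inequality of a strongly convex function. -/
theorem add_inner_gradient_add_sq_le {μ : ℝ} (hc : StrongConvexOn Set.univ μ φ) (hμ : 0 ≤ μ)
    (hφ : Differentiable ℝ φ) (x y : E d) :
    φ x + inner ℝ (gradient φ x) (y - x) + μ / 2 * ‖y - x‖ ^ 2 ≤ φ y := by
  have hconv : ConvexOn ℝ Set.univ φ := UniformConvexOn.convexOn hc fun s => by dsimp; positivity
  -- Strong convexity at (1 - s)x + sy gives, after division by s, the modulus term with factor 1 -
  -- s; the missing part vanishes as s → 0.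
  refine le_of_forall_le_add_mul (c := μ / 2 * ‖y - x‖ ^ 2) fun s hs hs1 => ?_
  have h1 := hc.2 (Set.mem_univ x) (Set.mem_univ y) (by linarith : 0 ≤ 1 - s) hs.le (by ring)
  have h2 := add_inner_gradient_le hconv hφ x ((1 - s) • x + s • y)
  have e : (1 - s) • x + s • y - x = s • (y - x) := by module
  rw [e, inner_smul_right] at h2
  rw [norm_sub_rev] at h1
  simp only [smul_eq_mul] at h1
  have h3 : s * (inner ℝ (gradient φ x) (y - x) + (1 - s) * (μ / 2 * ‖y - x‖ ^ 2) + φ x - φ y)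
      ≤ s * 0 := by nlinarith
  have := le_of_mul_le_mul_left h3 hs
  linarith

theorem mul_norm_sq_le_inner_gradient_sub {μ : ℝ} (hc : StrongConvexOn Set.univ μ φ) (hμ : 0 ≤ μ)
    (hφ : Differentiable ℝ φ) (x y : E d) :
    μ * ‖x - y‖ ^ 2 ≤ inner ℝ (gradient φ x - gradient φ y) (x - y) := by
  have h1 := add_inner_gradient_add_sq_le hc hμ hφ x y
  have h2 := add_inner_gradient_add_sq_le hc hμ hφ y x
  have e : y - x = -(x - y) := by abel
  rw [e, inner_neg_right, norm_neg] at h1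
  rw [inner_sub_left]
  linarith

theorem IsSmoothFun.continuous_gradient (hφ : IsSmoothFun L φ) : Continuous (gradient φ) := by
  have : LipschitzWith (Real.toNNReal L) (gradient φ) := by
    refine LipschitzWith.of_dist_le_mul fun x y => ?_
    rw [dist_eq_norm, dist_eq_norm]
    refine (hφ.2 x y).trans ?_
    gcongr
    exact Real.le_coe_toNNReal L
  exact this.continuous

end Smooth

/-! ### The expected objective: measurability, integrability and differentiation under the
expectation. -/

section Mean

variable {d m : ℕ} {Ξ : Type*} [MeasurableSpace Ξ] {Q : Problem d m Ξ} {p : Params}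
  {P : Measure Ξ}

theorem eq_sum_inner_basisFun (x : E d) :
    x = ∑ k, (inner ℝ x (EuclideanSpace.basisFun (Fin d) ℝ k) : ℝ) •
      EuclideanSpace.basisFun (Fin d) ℝ k := by
  conv_lhs => rw [← (EuclideanSpace.basisFun (Fin d) ℝ).sum_repr' x]
  exact Finset.sum_congr rfl fun k _ => by rw [real_inner_comm]

/-- A directional derivative is a pointwise limit of difference quotients of function values, and
these are measurable in the sample. -/
theorem measurable_inner_gradient (hs : Q.IsStochastic P) (hc : Q.ConvexSmooth p) (x v : E d) :
    Measurable fun ξ => (inner ℝ (gradient (Q.f ξ) x) v : ℝ) := by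
  refine measurable_of_tendsto_metrizable (f := fun (n : ℕ) ξ =>
    ((1 : ℝ) / (n + 1))⁻¹ * (Q.f ξ (x + ((1 : ℝ) / (n + 1)) • v) - Q.f ξ x)) (fun n =>
      (((hs _).1).sub (hs _).1).const_mul _) ?_
  rw [tendsto_pi_nhds]
  intro ξ
  have h0 := hasDerivAt_comp_line (hc.f_smooth ξ).1 x v 0
  rw [hasDerivAt_iff_tendsto_slope_zero] at h0
  have hseq : Filter.Tendsto (fun n : ℕ => (1 : ℝ) / (n + 1)) Filter.atTop
      (nhdsWithin 0 {0}ᶜ) := by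
    refine tendsto_nhdsWithin_iff.2 ⟨tendsto_one_div_add_atTop_nhds_zero_nat, ?_⟩
    exact Filter.Eventually.of_forall fun n => by
      have : (0 : ℝ) < 1 / ((n : ℝ) + 1) := by positivity
      exact this.ne'
  have := h0.comp hseq
  simpa only [Function.comp_def, zero_add, zero_smul, add_zero, smul_eq_mul] using this

/-- Only function values are assumed integrable; the Taylor bound dominates the derivative in
direction `v` by a difference of values plus a constant. -/
theorem integrable_inner_gradient [IsProbabilityMeasure P] (hs : Q.IsStochastic P)
    (hc : Q.ConvexSmooth p) (x v : E d) :
    Integrable (fun ξ => (inner ℝ (gradient (Q.f ξ) x) v : ℝ)) P := by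
  refine Integrable.mono' (g := fun ξ => |Q.f ξ (x + v) - Q.f ξ x| + p.Lf / 2 * ‖v‖ ^ 2)
    ((((hs _).2.sub (hs _).2).abs).add (integrable_const _))
    (measurable_inner_gradient hs hc x v).aestronglyMeasurable
    (Filter.Eventually.of_forall fun ξ => ?_)
  have h1 := (hc.f_smooth ξ).abs_sub_le x (x + v)
  rw [add_sub_cancel_left] at h1
  rw [Real.norm_eq_abs]
  set I : ℝ := inner ℝ (gradient (Q.f ξ) x) v
  set D := Q.f ξ (x + v) - Q.f ξ x
  calc |I| = |D - (D - I)| := by rw [sub_sub_cancel]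
    _ ≤ |D| + |D - I| := abs_sub _ _
    _ ≤ _ := by gcongr

/-- The stochastic gradient at a fixed point is measurable in the sample. -/
theorem measurable_gradient (hs : Q.IsStochastic P) (hc : Q.ConvexSmooth p) (x : E d) :
    Measurable fun ξ => gradient (Q.f ξ) x := by
  have : (fun ξ => gradient (Q.f ξ) x) = fun ξ => ∑ k, (inner ℝ (gradient (Q.f ξ) x)
      (EuclideanSpace.basisFun (Fin d) ℝ k) : ℝ) • EuclideanSpace.basisFun (Fin d) ℝ k :=
    funext fun ξ => eq_sum_inner_basisFun _
  rw [this]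
  exact Finset.measurable_sum _ fun k _ => (measurable_inner_gradient hs hc x _).smul_const _

theorem integrable_gradient [IsProbabilityMeasure P] (hs : Q.IsStochastic P)
    (hc : Q.ConvexSmooth p) (x : E d) : Integrable (fun ξ => gradient (Q.f ξ) x) P := by
  have : (fun ξ => gradient (Q.f ξ) x) = fun ξ => ∑ k, (inner ℝ (gradient (Q.f ξ) x)
      (EuclideanSpace.basisFun (Fin d) ℝ k) : ℝ) • EuclideanSpace.basisFun (Fin d) ℝ k :=
    funext fun ξ => eq_sum_inner_basisFun _
  rw [this]
  exact integrable_finsetSum _ fun k _ => (integrable_inner_gradient hs hc x _).smul_const _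

/-- Differentiation under the expectation. -/
theorem hasGradientAt_mean [IsProbabilityMeasure P] (hs : Q.IsStochastic P)
    (hc : Q.ConvexSmooth p) (x : E d) :
    HasGradientAt (Q.mean P) (∫ ξ, gradient (Q.f ξ) x ∂P) x := by
  rw [hasGradientAt_iff_isLittleO]
  -- The Taylor remainder is quadratic uniformly in the sample, so it may simply be integrated; no
  -- dominated convergence is needed.
  refine Asymptotics.IsBigO.trans_isLittleO (g := fun y => ‖y - x‖ ^ 2) ?_
    (Asymptotics.isLittleO_pow_sub_sub x one_lt_two)
  refine Asymptotics.IsBigO.of_bound (p.Lf / 2) (Filter.Eventually.of_forall fun y => ?_)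
  have e : Q.mean P y - Q.mean P x - inner ℝ (∫ ξ, gradient (Q.f ξ) x ∂P) (y - x)
      = ∫ ξ, (Q.f ξ y - Q.f ξ x - inner ℝ (gradient (Q.f ξ) x) (y - x)) ∂P := by
    have h1 := integral_sub (f := fun ξ => Q.f ξ y - Q.f ξ x) ((hs y).2.sub (hs x).2)
      (integrable_inner_gradient hs hc x (y - x))
    rw [h1, integral_sub (hs y).2 (hs x).2, real_inner_comm,
      ← integral_inner (integrable_gradient hs hc x)]
    simp only [real_inner_comm, Problem.mean]
  rw [e, norm_pow, norm_norm]
  have := norm_integral_le_of_norm_le_const (μ := P) (C := p.Lf / 2 * ‖y - x‖ ^ 2)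
    (f := fun ξ => Q.f ξ y - Q.f ξ x - inner ℝ (gradient (Q.f ξ) x) (y - x))
    (Filter.Eventually.of_forall fun ξ => (hc.f_smooth ξ).abs_sub_le x y)
  simpa using this

theorem gradient_mean [IsProbabilityMeasure P] (hs : Q.IsStochastic P)
    (hc : Q.ConvexSmooth p) (x : E d) :
    gradient (Q.mean P) x = ∫ ξ, gradient (Q.f ξ) x ∂P :=
  (hasGradientAt_mean hs hc x).gradient

theorem integral_inner_gradient [IsProbabilityMeasure P] (hs : Q.IsStochastic P)
    (hc : Q.ConvexSmooth p) (x v : E d) :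
    ∫ ξ, (inner ℝ (gradient (Q.f ξ) x) v : ℝ) ∂P = inner ℝ (gradient (Q.mean P) x) v := by
  rw [gradient_mean hs hc, real_inner_comm, ← integral_inner (integrable_gradient hs hc x)]
  simp only [real_inner_comm]

theorem differentiable_mean [IsProbabilityMeasure P] (hs : Q.IsStochastic P)
    (hc : Q.ConvexSmooth p) : Differentiable ℝ (Q.mean P) :=
  fun x => (hasGradientAt_mean hs hc x).differentiableAt

/-- The stochastic gradient is jointly measurable. -/
theorem measurable_uncurry_gradient (hs : Q.IsStochastic P) (hc : Q.ConvexSmooth p) :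
    Measurable fun q : E d × Ξ => gradient (Q.f q.2) q.1 :=
  measurable_uncurry_of_continuous_of_measurable (u := fun x ξ => gradient (Q.f ξ) x)
    (fun ξ => (hc.f_smooth ξ).continuous_gradient) (measurable_gradient hs hc)

end Mean

/-! ### The regulariser on its effective domain. -/

section Domain

variable {d : ℕ} {h : E d → EReal}

theorem IsProperClosedConvex.coe_toReal (hp : IsProperClosedConvex h) {u : E d} (hu : h u ≠ ⊤) :
    ((h u).toReal : EReal) = h u :=
  EReal.coe_toReal hu (hp.ne_bot u)

/-- A proper convex function is convex as a real function on its effective domain. -/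
theorem IsProperClosedConvex.convexOn_toReal (hp : IsProperClosedConvex h) :
    ConvexOn ℝ {u | h u ≠ ⊤} fun u => (h u).toReal := by
  have key : ∀ ⦃x : E d⦄, h x ≠ ⊤ → ∀ ⦃y : E d⦄, h y ≠ ⊤ → ∀ ⦃a b : ℝ⦄, 0 ≤ a → 0 ≤ b →
      a + b = 1 → h (a • x + b • y) ≤ ((a * (h x).toReal + b * (h y).toReal : ℝ) : EReal) := by
    intro x hx y hy a b ha hb hab
    have := hp.convex (x := (x, (h x).toReal)) (hp.coe_toReal hx).ge
      (y := (y, (h y).toReal)) (hp.coe_toReal hy).ge ha hb hab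
    simpa using this
  refine ⟨fun x hx y hy a b ha hb hab => ?_, fun x hx y hy a b ha hb hab => ?_⟩
  · exact ne_top_of_le_ne_top (EReal.coe_ne_top _) (key hx hy ha hb hab)
  · have h1 := key hx hy ha hb hab
    have h2 : h (a • x + b • y) ≠ ⊤ := ne_top_of_le_ne_top (EReal.coe_ne_top _) h1
    rw [← hp.coe_toReal h2, EReal.coe_le_coe_iff] at h1
    exact h1

/-- A subgradient of a proper function exists only inside the effective domain. -/
theorem IsProperClosedConvex.ne_top_of_mem_subdifferential (hp : IsProperClosedConvex h)
    {x v : E d} (hv : v ∈ subdifferential h x) : h x ≠ ⊤ := by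
  obtain ⟨y, hy⟩ := hp.exists_ne_top
  intro hx
  have := hv y
  rw [hx, EReal.top_add_coe, top_le_iff] at this
  exact hy this

theorem IsProperClosedConvex.add_inner_le_toReal (hp : IsProperClosedConvex h) {x v : E d}
    (hv : v ∈ subdifferential h x) {y : E d} (hy : h y ≠ ⊤) :
    (h x).toReal + inner ℝ v (y - x) ≤ (h y).toReal := by
  have := hv y
  rw [← hp.coe_toReal (hp.ne_top_of_mem_subdifferential hv), ← hp.coe_toReal hy,
    ← EReal.coe_add, EReal.coe_le_coe_iff] at this
  exact this

end Domain

/-! ### Optimality of the solution and an exact penalty whose slope does not depend on m. -/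

/-- The standing assumptions of the problem. -/
structure Assumptions {d m : ℕ} {Ξ : Type*} [MeasurableSpace Ξ] (Q : Problem d m Ξ)
    (P : Measure Ξ) (p : Params) (r B σ G Bt : ℝ) (xs xt : E d) : Prop where
  r_pos : 0 < r
  ν_pos : 0 < p.ν
  Lg_nonneg : 0 ≤ p.Lg
  μ_pos : 0 < p.μ
  μ_le : p.μ ≤ p.Lf
  m_pos : 0 < m
  stoch : Q.IsStochastic P
  smooth : Q.ConvexSmooth p
  sol : Q.IsSolution P xs
  slater : Q.Slater P p.ν Bt xs xt
  strong : StrongConvexOn Set.univ p.μ (Q.mean P)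
  variance : Q.BoundedVariance P σ xs
  grads : Q.BoundedGradients P G B xs
  regular : Q.LinearlyRegular r

/-- The first-order change of the objective from `xs` to `u`: linear in the smooth part, exact in
the regulariser. -/
noncomputable def Problem.linGap {d m : ℕ} {Ξ : Type*} [MeasurableSpace Ξ] (Q : Problem d m Ξ)
    (P : Measure Ξ) (xs u : E d) : ℝ :=
  inner ℝ (gradient (Q.mean P) xs) (u - xs) + (Q.h u).toReal - (Q.h xs).toReal

/-- The slope of the exact penalty for leaving the feasible set. -/
noncomputable def penaltySlope (r G Bt ν Lg : ℝ) : ℝ :=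
  2 * (Bt / ν * (2 * (|G| + 1) / √r + Lg))

namespace Assumptions

variable {d m : ℕ} {Ξ : Type*} [MeasurableSpace Ξ] {Q : Problem d m Ξ} {P : Measure Ξ}
  {p : Params} {r B σ G Bt : ℝ} {xs xt : E d}

theorem Lf_pos (H : Assumptions Q P p r B σ G Bt xs xt) : 0 < p.Lf := H.μ_pos.trans_le H.μ_le

theorem h_xs (H : Assumptions Q P p r B σ G Bt xs xt) : Q.h xs ≠ ⊤ := by
  obtain ⟨-, v, hv, -⟩ := H.grads
  exact H.smooth.h_pcc.ne_top_of_mem_subdifferential hv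

theorem h_xt (H : Assumptions Q P p r B σ G Bt xs xt) : Q.h xt ≠ ⊤ := by
  have h1 := H.slater.2
  intro hx
  rw [Problem.objective, Problem.objective, hx, EReal.coe_add_top, top_le_iff,
    ← H.smooth.h_pcc.coe_toReal H.h_xs, ← EReal.coe_add, ← EReal.coe_add] at h1
  exact EReal.coe_ne_top _ h1

theorem objective_xt_le (H : Assumptions Q P p r B σ G Bt xs xt) :
    Q.mean P xt + (Q.h xt).toReal ≤ Q.mean P xs + (Q.h xs).toReal + Bt := by
  have h1 := H.slater.2
  rw [Problem.objective, Problem.objective, ← H.smooth.h_pcc.coe_toReal H.h_xs,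
    ← H.smooth.h_pcc.coe_toReal H.h_xt, ← EReal.coe_add, ← EReal.coe_add, ← EReal.coe_add,
    EReal.coe_le_coe_iff] at h1
  exact h1

theorem objective_xs_le (H : Assumptions Q P p r B σ G Bt xs xt) {u : E d}
    (hu : u ∈ Q.feasibleSet) (hd : Q.h u ≠ ⊤) :
    Q.mean P xs + (Q.h xs).toReal ≤ Q.mean P u + (Q.h u).toReal := by
  have h1 := H.sol.2 u hu
  rw [Problem.objective, Problem.objective, ← H.smooth.h_pcc.coe_toReal H.h_xs,
    ← H.smooth.h_pcc.coe_toReal hd, ← EReal.coe_add, ← EReal.coe_add,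
    EReal.coe_le_coe_iff] at h1
  exact h1

theorem convex_constraintSet (H : Assumptions Q P p r B σ G Bt xs xt) (j : Fin m) :
    Convex ℝ (Q.constraintSet j) := by
  simpa [Problem.constraintSet] using (H.smooth.g_convex j).convex_le 0

theorem isClosed_constraintSet (H : Assumptions Q P p r B σ G Bt xs xt) (j : Fin m) :
    IsClosed (Q.constraintSet j) :=
  isClosed_le (H.smooth.g_smooth j).1.continuous continuous_const

theorem convex_feasibleSet (H : Assumptions Q P p r B σ G Bt xs xt) :
    Convex ℝ Q.feasibleSet :=
  convex_iInter H.convex_constraintSet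

theorem isClosed_feasibleSet (H : Assumptions Q P p r B σ G Bt xs xt) :
    IsClosed Q.feasibleSet :=
  isClosed_iInter H.isClosed_constraintSet

theorem xt_mem (H : Assumptions Q P p r B σ G Bt xs xt) : xt ∈ Q.feasibleSet :=
  Set.mem_iInter.2 fun j => (H.slater.1 j).trans (by linarith [H.ν_pos])

theorem linGap_convexOn (H : Assumptions Q P p r B σ G Bt xs xt) :
    ConvexOn ℝ {u | Q.h u ≠ ⊤} (Q.linGap P xs) := by
  have hc := H.smooth.h_pcc.convexOn_toReal
  refine ⟨hc.1, fun x hx y hy a b ha hb hab => ?_⟩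
  have h1 := hc.2 hx hy ha hb hab
  have e : a • x + b • y - xs = a • (x - xs) + b • (y - xs) := by
    have : xs = a • xs + b • xs := by rw [← add_smul, hab, one_smul]
    conv_lhs => rw [this]
    module
  simp only [smul_eq_mul] at h1 ⊢
  simp only [Problem.linGap]
  rw [e, inner_add_right, inner_smul_right, inner_smul_right]
  obtain rfl : b = 1 - a := by linarith
  linarith

theorem linGap_xs : Q.linGap P xs xs = 0 := by simp [Problem.linGap]

/-- A penalty bound near the solution extends to the whole domain by convexity. -/
theorem penalty_of_local (H : Assumptions Q P p r B σ G Bt xs xt) {M : ℝ} (hM : 0 ≤ M)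
    (hloc : ∀ u, Q.h u ≠ ⊤ → ‖u - xs‖ ≤ 1 →
      0 ≤ Q.linGap P xs u + M * Metric.infDist u Q.feasibleSet)
    {u : E d} (hd : Q.h u ≠ ⊤) :
    0 ≤ Q.linGap P xs u + M * Metric.infDist u Q.feasibleSet := by
  -- This scales `u` into the unit ball around `xs`. Both `linGap` and the distance to the feasible
  -- set are convex and vanish at `xs`, so each shrinks at least by the factor `s`.
  set s := 1 / (1 + ‖u - xs‖) with hs
  have hpos : 0 < 1 + ‖u - xs‖ := by positivity
  have hs0 : 0 < s := by positivity
  have hs1 : 0 ≤ 1 - s := by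
    rw [sub_nonneg, hs, div_le_one hpos]; linarith [norm_nonneg (u - xs)]
  have hcv := H.linGap_convexOn
  have h1 := hcv.2 H.h_xs hd hs1 hs0.le (by ring)
  have h2 := hloc _ (hcv.1 H.h_xs hd hs1 hs0.le (by ring)) (by
    have e : (1 - s) • xs + s • u - xs = s • (u - xs) := by module
    rw [e, norm_smul, Real.norm_of_nonneg hs0.le, hs, one_div_mul_eq_div, div_le_one hpos]
    linarith)
  obtain ⟨y, hy, hδ⟩ := H.isClosed_feasibleSet.exists_infDist_eq_dist ⟨xs, H.sol.1⟩ u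
  have h3 := Metric.infDist_le_dist_of_mem (x := (1 - s) • xs + s • u)
    (H.convex_feasibleSet H.sol.1 hy hs1 hs0.le (by ring))
  rw [dist_add_left, dist_smul₀, ← hδ, Real.norm_of_nonneg hs0.le] at h3
  rw [linGap_xs] at h1
  simp only [smul_eq_mul, mul_zero, zero_add] at h1
  have h4 : M * Metric.infDist ((1 - s) • xs + s • u) Q.feasibleSet
      ≤ M * (s * Metric.infDist u Q.feasibleSet) := by gcongr
  have h5 : 0 ≤ s * (Q.linGap P xs u + M * Metric.infDist u Q.feasibleSet) := by linarith
  exact nonneg_of_mul_nonneg_right h5 hs0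

variable [IsProbabilityMeasure P]

theorem mean_gradient_le (H : Assumptions Q P p r B σ G Bt xs xt) (x y : E d) :
    Q.mean P x + inner ℝ (gradient (Q.mean P) x) (y - x) + p.μ / 2 * ‖y - x‖ ^ 2 ≤ Q.mean P y :=
  add_inner_gradient_add_sq_le H.strong H.μ_pos.le (differentiable_mean H.stoch H.smooth) x y

/-- First-order optimality of the solution. -/
theorem linGap_nonneg (H : Assumptions Q P p r B σ G Bt xs xt) {u : E d}
    (hu : u ∈ Q.feasibleSet) (hd : Q.h u ≠ ⊤) : 0 ≤ Q.linGap P xs u := by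
  have hder := hasDerivAt_comp_line (differentiable_mean H.stoch H.smooth) xs (u - xs) 0
  rw [hasDerivAt_iff_tendsto_slope_zero] at hder
  have h1 : -((Q.h u).toReal - (Q.h xs).toReal)
      ≤ inner ℝ (gradient (Q.mean P) xs) (u - xs) := by
    simp only [zero_add, zero_smul, add_zero, smul_eq_mul] at hder
    have hder' := hder.mono_left (nhdsWithin_mono 0 (fun s (hs : s ∈ Set.Ioi (0:ℝ)) => ne_of_gt hs))
    refine ge_of_tendsto hder' ?_
    filter_upwards [Ioo_mem_nhdsGT (zero_lt_one' ℝ)] with s hs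
    have e : xs + s • (u - xs) = (1 - s) • xs + s • u := by module
    have hs1 : 0 ≤ 1 - s := by linarith [hs.2]
    have hc := H.smooth.h_pcc.convexOn_toReal
    have hf := H.convex_feasibleSet H.sol.1 hu hs1 hs.1.le (by ring)
    have hd' := hc.1 H.h_xs hd hs1 hs.1.le (by ring)
    have h2 := H.objective_xs_le hf hd'
    have h3 := hc.2 H.h_xs hd hs1 hs.1.le (by ring)
    simp only [smul_eq_mul] at h3
    rw [e, inv_mul_eq_div, le_div_iff₀ hs.1]
    linarith
  rw [Problem.linGap]
  linarith

theorem linGap_xt_le (H : Assumptions Q P p r B σ G Bt xs xt) : Q.linGap P xs xt ≤ Bt := by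
  have h1 := H.mean_gradient_le xs xt
  have h2 := H.objective_xt_le
  have h3 : 0 ≤ p.μ / 2 * ‖xt - xs‖ ^ 2 := by have := H.μ_pos; positivity
  rw [Problem.linGap]
  linarith

theorem Bt_nonneg (H : Assumptions Q P p r B σ G Bt xs xt) : 0 ≤ Bt :=
  (H.linGap_nonneg H.xt_mem H.h_xt).trans H.linGap_xt_le

/-- Strong convexity together with first-order optimality of `xs` in the direction of the feasible
point `xt`. It locates the Slater point, on which the inner loop length depends. -/
theorem norm_xt_sub_sq_le (H : Assumptions Q P p r B σ G Bt xs xt) :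
    ‖xt - xs‖ ^ 2 ≤ 2 * Bt / p.μ := by
  have h1 := H.mean_gradient_le xs xt
  have h2 := H.objective_xt_le
  have h3 := H.linGap_nonneg H.xt_mem H.h_xt
  rw [Problem.linGap] at h3
  rw [le_div_iff₀ H.μ_pos]
  linarith

/-- Moving from `u` towards the Slater point by the relative amount `ρ`, the constraints with
moderate gradients become satisfied, and the distance to the feasible set shrinks. -/
theorem exists_shift (H : Assumptions Q P p r B σ G Bt xs xt) {u : E d} (hd : Q.h u ≠ ⊤)
    (hu : ‖u - xs‖ ≤ 1) {K : ℝ} (hK : 0 ≤ K) :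
    ∃ w, Q.h w ≠ ⊤ ∧
      (∀ j, ‖gradient (Q.g j) xs‖ ≤ K → w ∈ Q.constraintSet j) ∧
      (∀ j, (1 + (K + p.Lg) * Metric.infDist u Q.feasibleSet / p.ν) *
        Metric.infDist w (Q.constraintSet j) ≤ Metric.infDist u Q.feasibleSet) ∧
      (1 + (K + p.Lg) * Metric.infDist u Q.feasibleSet / p.ν) * Q.linGap P xs w
        ≤ Q.linGap P xs u + (K + p.Lg) * Metric.infDist u Q.feasibleSet / p.ν * Bt := by
  obtain ⟨y, hy, hδ⟩ := H.isClosed_feasibleSet.exists_infDist_eq_dist ⟨xs, H.sol.1⟩ u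
  set δ := Metric.infDist u Q.feasibleSet
  have hδ0 : 0 ≤ δ := Metric.infDist_nonneg
  have hν := H.ν_pos
  have hLg := H.Lg_nonneg
  -- Within distance 1 of `xs`, a moderate gradient has norm at most K + Lg, so the violation at `u`
  -- is at most (K + Lg)δ. This `ρ` is the amount of Slater margin that offsets it.
  set ρ := (K + p.Lg) * δ / p.ν with hρ
  have hρ0 : 0 ≤ ρ := by positivity
  have hρν : ρ * p.ν = (K + p.Lg) * δ := by rw [hρ]; field_simp
  have h1ρ : 0 < 1 + ρ := by linarith
  have ha : 0 ≤ 1 / (1 + ρ) := by positivity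
  have hb : 0 ≤ ρ / (1 + ρ) := by positivity
  have hab : 1 / (1 + ρ) + ρ / (1 + ρ) = 1 := by field_simp
  refine ⟨(1 / (1 + ρ)) • u + (ρ / (1 + ρ)) • xt, H.linGap_convexOn.1 hd H.h_xt ha hb hab,
    fun j hj => ?_, fun j => ?_, ?_⟩
  · have h1 := (H.smooth.g_convex j).2 (Set.mem_univ u) (Set.mem_univ xt) ha hb hab
    have h2 := add_inner_gradient_le (H.smooth.g_convex j) (H.smooth.g_smooth j).1 u y
    have h3 : Q.g j y ≤ 0 := Set.mem_iInter.1 hy j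
    have h4 : -(inner ℝ (gradient (Q.g j) u) (y - u) : ℝ) ≤ (K + p.Lg) * δ := by
      rw [← inner_neg_right, neg_sub]
      refine (real_inner_le_norm _ _).trans ?_
      rw [← dist_eq_norm u y, ← hδ]
      gcongr
      have h5 := (H.smooth.g_smooth j).2 u xs
      have h6 := norm_le_norm_add_norm_sub' (gradient (Q.g j) u) (gradient (Q.g j) xs)
      have h7 : p.Lg * ‖u - xs‖ ≤ p.Lg * 1 := by gcongr
      linarith
    have h8 := H.slater.1 j
    change Q.g j _ ≤ 0
    refine h1.trans ?_
    simp only [smul_eq_mul]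
    have h9 : 1 / (1 + ρ) * Q.g j u + ρ / (1 + ρ) * Q.g j xt = (Q.g j u + ρ * Q.g j xt) / (1 + ρ) := by
      ring
    rw [h9]
    refine div_nonpos_of_nonpos_of_nonneg ?_ h1ρ.le
    have : ρ * Q.g j xt ≤ ρ * (-p.ν) := by gcongr
    linarith
  -- The projection `y`, shifted by the same amount, stays feasible; the two shifted points are δ/(1
  -- + ρ) apart, for every constraint.
  · have hmem : (1 / (1 + ρ)) • y + (ρ / (1 + ρ)) • xt ∈ Q.constraintSet j :=
      Set.mem_iInter.1 (H.convex_feasibleSet hy H.xt_mem ha hb hab) j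
    have h1 := Metric.infDist_le_dist_of_mem (x := (1 / (1 + ρ)) • u + (ρ / (1 + ρ)) • xt) hmem
    rw [dist_add_right, dist_smul₀, ← hδ, Real.norm_of_nonneg ha] at h1
    calc _ ≤ (1 + ρ) * (1 / (1 + ρ) * δ) := by gcongr
      _ = δ := by field_simp
  · have h1 := H.linGap_convexOn.2 hd H.h_xt ha hb hab
    simp only [smul_eq_mul] at h1
    have h2 : ρ * Q.linGap P xs xt ≤ ρ * Bt := by have := H.linGap_xt_le; gcongr
    calc _ ≤ (1 + ρ) * (1 / (1 + ρ) * Q.linGap P xs u + ρ / (1 + ρ) * Q.linGap P xs xt) := by gcongr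
      _ = Q.linGap P xs u + ρ * Q.linGap P xs xt := by field_simp
      _ ≤ _ := by linarith

/-- Linear regularity improves a penalty slope `M` to `M / 2` plus a constant. -/
theorem penalty_halve (H : Assumptions Q P p r B σ G Bt xs xt) {M : ℝ} (hM : 0 ≤ M)
    (hpen : ∀ u, Q.h u ≠ ⊤ → 0 ≤ Q.linGap P xs u + M * Metric.infDist u Q.feasibleSet)
    {u : E d} (hd : Q.h u ≠ ⊤) :
    0 ≤ Q.linGap P xs u + (M / 2 + penaltySlope r G Bt p.ν p.Lg / 2) *
      Metric.infDist u Q.feasibleSet := by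
  have hBt := H.Bt_nonneg
  have hν := H.ν_pos
  have hLg := H.Lg_nonneg
  have hr : 0 < √r := Real.sqrt_pos.2 H.r_pos
  have hm : (0 : ℝ) < m := by exact_mod_cast H.m_pos
  -- Chosen so that G²/K² ≤ r/4, which halves the distance after linear regularity; the `+ 1` keeps
  -- `K` positive when `G = 0`.
  set K := 2 * (|G| + 1) / √r with hK
  have hK0 : 0 < K := by positivity
  have hS : penaltySlope r G Bt p.ν p.Lg / 2 = Bt / p.ν * (K + p.Lg) := by
    rw [penaltySlope, hK]; ring
  refine H.penalty_of_local (by rw [hS]; positivity) (fun u hd hu => ?_) hd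
  obtain ⟨w, hw, hgood, hdist, hgap⟩ := H.exists_shift hd hu hK0.le
  rw [hS]
  set δ := Metric.infDist u Q.feasibleSet
  have hδ0 : 0 ≤ δ := Metric.infDist_nonneg
  set ρ := (K + p.Lg) * δ / p.ν with hρ
  have hρ0 : 0 ≤ ρ := by positivity
  -- A Chebyshev-type bound: repaired constraints contribute 0, and a large gradient pays for its
  -- own distance through ‖∇g_j‖²/K² ≥ 1.
  have hj : ∀ j, ((1 + ρ) * Metric.infDist w (Q.constraintSet j)) ^ 2
      ≤ δ ^ 2 / K ^ 2 * ‖gradient (Q.g j) xs‖ ^ 2 := by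
    intro j
    by_cases hjK : ‖gradient (Q.g j) xs‖ ≤ K
    · rw [Metric.infDist_zero_of_mem (hgood j hjK), mul_zero, zero_pow two_ne_zero]
      positivity
    · have h1 : 0 ≤ (1 + ρ) * Metric.infDist w (Q.constraintSet j) :=
        mul_nonneg (by linarith) Metric.infDist_nonneg
      calc _ ≤ δ ^ 2 := pow_le_pow_left₀ h1 (hdist j) 2
        _ = δ ^ 2 / K ^ 2 * K ^ 2 := by field_simp
        _ ≤ _ := by
          have := (not_le.1 hjK).le
          gcongr
  have hsum : (1 + ρ) ^ 2 * ((∑ j, Metric.infDist w (Q.constraintSet j) ^ 2) / m)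
      ≤ δ ^ 2 / K ^ 2 * ((∑ j, ‖gradient (Q.g j) xs‖ ^ 2) / m) := by
    rw [← mul_div_assoc, ← mul_div_assoc, Finset.mul_sum, Finset.mul_sum]
    refine div_le_div_of_nonneg_right (Finset.sum_le_sum fun j _ => ?_) hm.le
    rw [← mul_pow]
    exact hj j
  have hG := H.grads.1
  have hreg := H.regular w
  have hK2 : K ^ 2 = 4 * (|G| + 1) ^ 2 / r := by
    rw [hK, div_pow, Real.sq_sqrt H.r_pos.le]; ring
  have hGK : r * (δ / 2) ^ 2 ≥ δ ^ 2 / K ^ 2 * G ^ 2 := by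
    rw [hK2, ← sq_abs G]
    have h1 : |G| ^ 2 ≤ (|G| + 1) ^ 2 := by gcongr; linarith
    have h2 : δ ^ 2 / (4 * (|G| + 1) ^ 2 / r) * |G| ^ 2
        = r * (δ / 2) ^ 2 * (|G| ^ 2 / (|G| + 1) ^ 2) := by
      have := H.r_pos
      have := abs_nonneg G
      field_simp
      ring
    rw [h2]
    have hr := H.r_pos
    refine mul_le_of_le_one_right (by positivity) ((div_le_one (by positivity)).2 h1)
  have hfin : ((1 + ρ) * Metric.infDist w Q.feasibleSet) ^ 2 ≤ (δ / 2) ^ 2 := by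
    refine le_of_mul_le_mul_left (a := r) ?_ H.r_pos
    calc r * ((1 + ρ) * Metric.infDist w Q.feasibleSet) ^ 2
        = (1 + ρ) ^ 2 * (r * Metric.infDist w Q.feasibleSet ^ 2) := by ring
      _ ≤ (1 + ρ) ^ 2 * ((∑ j, Metric.infDist w (Q.constraintSet j) ^ 2) / m) := by gcongr
      _ ≤ _ := hsum
      _ ≤ δ ^ 2 / K ^ 2 * G ^ 2 := by gcongr
      _ ≤ _ := hGK
  have hw2 : (1 + ρ) * Metric.infDist w Q.feasibleSet ≤ δ / 2 :=
    le_of_sq_le_sq hfin (by positivity)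
  have hpw := mul_nonneg (by linarith : 0 ≤ 1 + ρ) (hpen w hw)
  have h1 : M * ((1 + ρ) * Metric.infDist w Q.feasibleSet) ≤ M * (δ / 2) := by gcongr
  have h2 : ρ * Bt = Bt / p.ν * (K + p.Lg) * δ := by rw [hρ]; ring
  linarith

/-- Exact penalty: leaving the feasible set lowers the first-order model of the objective at most
linearly in the distance, with a slope independent of the number of constraints. -/
theorem neg_penalty_le_linGap (H : Assumptions Q P p r B σ G Bt xs xt) {u : E d}
    (hd : Q.h u ≠ ⊤) :
    0 ≤ Q.linGap P xs u + penaltySlope r G Bt p.ν p.Lg * Metric.infDist u Q.feasibleSet := by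
  have hBt := H.Bt_nonneg
  have hν := H.ν_pos
  have hLg := H.Lg_nonneg
  set S := penaltySlope r G Bt p.ν p.Lg with hS
  have hS0 : 0 ≤ S := by rw [hS, penaltySlope]; positivity
  -- With this crude threshold every constraint is repaired, so the shifted point is feasible. The
  -- resulting slope depends on m but serves only as a start.
  set K := ∑ j, ‖gradient (Q.g j) xs‖ with hK
  have hK0 : 0 ≤ K := by positivity
  set M := Bt / p.ν * (K + p.Lg) with hM
  have hM0 : 0 ≤ M := by positivity
  have hstart : ∀ u, Q.h u ≠ ⊤ → 0 ≤ Q.linGap P xs u + M * Metric.infDist u Q.feasibleSet := by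
    intro u hd
    refine H.penalty_of_local hM0 (fun u hd hu => ?_) hd
    obtain ⟨w, hw, hgood, -, hgap⟩ := H.exists_shift hd hu hK0
    have hwX : w ∈ Q.feasibleSet := Set.mem_iInter.2 fun j => hgood j
      (Finset.single_le_sum (f := fun j => ‖gradient (Q.g j) xs‖)
        (fun j _ => norm_nonneg _) (Finset.mem_univ j))
    have h1 := H.linGap_nonneg hwX hw
    have hδ0 : 0 ≤ Metric.infDist u Q.feasibleSet := Metric.infDist_nonneg
    have h2 : 0 ≤ (1 + (K + p.Lg) * Metric.infDist u Q.feasibleSet / p.ν) * Q.linGap P xs w := by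
      positivity
    have h3 : (K + p.Lg) * Metric.infDist u Q.feasibleSet / p.ν * Bt
        = M * Metric.infDist u Q.feasibleSet := by rw [hM]; ring
    linarith
  have hiter : ∀ k : ℕ, ∀ u, Q.h u ≠ ⊤ →
      0 ≤ Q.linGap P xs u + (M * (1 / 2) ^ k + S) * Metric.infDist u Q.feasibleSet := by
    intro k
    induction k with
    | zero =>
      intro u hd
      have h1 := hstart u hd
      have h2 : 0 ≤ S * Metric.infDist u Q.feasibleSet := mul_nonneg hS0 Metric.infDist_nonneg
      rw [pow_zero, mul_one, add_mul]
      linarith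
    | succ k ih =>
      intro u hd
      have := H.penalty_halve (by positivity) ih hd
      rw [← hS] at this
      have e : (M * (1 / 2) ^ k + S) / 2 + S / 2 = M * (1 / 2) ^ (k + 1) + S := by ring
      rwa [e] at this
  have hlim : Filter.Tendsto (fun k : ℕ => Q.linGap P xs u + (M * (1 / 2 : ℝ) ^ k + S) *
      Metric.infDist u Q.feasibleSet) Filter.atTop
      (nhds (Q.linGap P xs u + (M * 0 + S) * Metric.infDist u Q.feasibleSet)) := by
    refine Filter.Tendsto.const_add _ (Filter.Tendsto.mul_const _ (Filter.Tendsto.add_const _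
      (Filter.Tendsto.const_mul _ (tendsto_pow_atTop_nhds_zero_of_lt_one ?_ ?_)))) <;> norm_num
  rw [mul_zero, zero_add] at hlim
  exact ge_of_tendsto' hlim fun k => hiter k u hd

theorem penaltySlope_nonneg (H : Assumptions Q P p r B σ G Bt xs xt) :
    0 ≤ penaltySlope r G Bt p.ν p.Lg := by
  have hBt := H.Bt_nonneg
  have hν := H.ν_pos
  have hLg := H.Lg_nonneg
  rw [penaltySlope]
  positivity

end Assumptions

/-! ### Existence, three-point inequality and parameter dependence of proximal points. -/

section Prox

variable {d : ℕ} {h : E d → EReal} {x₀ v : E d} {c : E d → ℝ} {lam : ℝ}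

/-- The proximal subproblem has a minimiser. -/
theorem exists_isMinOn_prox (hp : IsProperClosedConvex h) (hv : v ∈ subdifferential h x₀)
    (hc : Continuous c) (hc0 : ∀ u, 0 ≤ c u) (hlam : 0 < lam) (z : E d) :
    ∃ u, IsMinOn (fun u => ((‖u - z‖ ^ 2 / (2 * lam) : ℝ) : EReal) + (h u + (c u : EReal)))
      Set.univ u := by
  set Θ : E d → EReal := fun u => ((‖u - z‖ ^ 2 / (2 * lam) : ℝ) : EReal) + (h u + (c u : EReal))
    with hΘ
  have hlsc : LowerSemicontinuous Θ := by
    have h1 : Continuous fun u : E d => ((‖u - z‖ ^ 2 / (2 * lam) : ℝ) : EReal) :=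
      continuous_coe_real_ereal.comp (by fun_prop)
    have h2 : Continuous fun u => (c u : EReal) := continuous_coe_real_ereal.comp hc
    have h3 : LowerSemicontinuous fun u => h u + (c u : EReal) :=
      hp.closed.add' h2.lowerSemicontinuous fun u =>
        EReal.continuousAt_add (Or.inr (EReal.coe_ne_bot _)) (Or.inr (EReal.coe_ne_top _))
    exact h1.lowerSemicontinuous.add' h3 fun u =>
      EReal.continuousAt_add (Or.inl (EReal.coe_ne_top _)) (Or.inl (EReal.coe_ne_bot _))
  have hx₀ := hp.ne_top_of_mem_subdifferential hv
  set C := ‖x₀ - z‖ ^ 2 / (2 * lam) + c x₀ + ‖v‖ * ‖z - x₀‖ with hC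
  have hC0 : 0 ≤ C := by have := hc0 x₀; positivity
  -- Outside this ball the quadratic outweighs the affine minorant of `h` given by `v`, so values
  -- are at least that at `x₀`; lower semicontinuity on the compact ball does the rest.
  set R := 2 * lam * (‖v‖ + 1) + C + ‖x₀ - z‖ with hR
  have hmem : x₀ ∈ Metric.closedBall z R := by
    rw [Metric.mem_closedBall, dist_eq_norm, hR]
    have : 0 ≤ 2 * lam * (‖v‖ + 1) := by positivity
    linarith
  obtain ⟨u, hu, hmin⟩ := LowerSemicontinuousOn.exists_isMinOn ⟨x₀, hmem⟩
    (isCompact_closedBall z R) (hlsc.lowerSemicontinuousOn _)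
  refine ⟨u, fun y _ => ?_⟩
  by_cases hy : y ∈ Metric.closedBall z R
  · exact hmin hy
  have hux : Θ u ≤ Θ x₀ := hmin hmem
  refine hux.trans ?_
  by_cases hyt : h y = ⊤
  · simp [hΘ, hyt]
  simp only [hΘ]
  rw [← hp.coe_toReal hx₀, ← hp.coe_toReal hyt, ← EReal.coe_add, ← EReal.coe_add, ← EReal.coe_add,
    ← EReal.coe_add, EReal.coe_le_coe_iff]
  rw [Metric.mem_closedBall, dist_eq_norm, not_le] at hy
  have h1 := hp.add_inner_le_toReal hv hyt
  have h2 : -(inner ℝ v (y - x₀) : ℝ) ≤ ‖v‖ * (‖y - z‖ + ‖z - x₀‖) := by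
    rw [← inner_neg_right]
    refine (real_inner_le_norm _ _).trans ?_
    rw [norm_neg]
    gcongr
    exact norm_sub_le_norm_sub_add_norm_sub _ _ _
  have h3 : C ≤ ‖y - z‖ * (‖y - z‖ / (2 * lam) - ‖v‖) := by
    have h4 : 1 ≤ ‖y - z‖ / (2 * lam) - ‖v‖ := by
      rw [le_sub_iff_add_le, le_div_iff₀ (by positivity)]
      have := norm_nonneg (x₀ - z)
      linarith
    have h5 : 0 ≤ 2 * lam * (‖v‖ + 1) := by positivity
    have h6 : C ≤ ‖y - z‖ := by
      have := norm_nonneg (x₀ - z)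
      linarith
    calc C ≤ ‖y - z‖ * 1 := by linarith
      _ ≤ _ := by gcongr
  have h7 : ‖y - z‖ * (‖y - z‖ / (2 * lam) - ‖v‖) = ‖y - z‖ ^ 2 / (2 * lam) - ‖v‖ * ‖y - z‖ := by
    ring
  have h8 := hc0 y
  linarith

theorem norm_combo_sub_sq {s t : ℝ} (hst : s + t = 1) (x y z : E d) :
    ‖s • x + t • y - z‖ ^ 2 = s * ‖x - z‖ ^ 2 + t * ‖y - z‖ ^ 2 - s * t * ‖x - y‖ ^ 2 := by
  obtain rfl : s = 1 - t := by linarith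
  have e1 : (1 - t) • x + t • y - z = (x - z) - t • (x - y) := by module
  have e2 : y - z = (x - z) - (x - y) := by abel
  rw [e1, e2, norm_sub_sq_real (x - z) (t • (x - y)), norm_sub_sq_real (x - z) (x - y), norm_smul,
    inner_smul_right, mul_pow, Real.norm_eq_abs, sq_abs]
  ring

/-- The proximal point lies in the domain and satisfies the three-point inequality. -/
theorem prox_spec (hp : IsProperClosedConvex h) (hv : v ∈ subdifferential h x₀)
    (hc : Continuous c) (hc0 : ∀ u, 0 ≤ c u) (hcc : ConvexOn ℝ Set.univ c) (hlam : 0 < lam)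
    (z : E d) {u : E d} (hu : prox lam (fun u => h u + (c u : EReal)) z = u) :
    h u ≠ ⊤ ∧ ∀ y, h y ≠ ⊤ →
      ‖u - z‖ ^ 2 / (2 * lam) + (h u).toReal + c u + ‖y - u‖ ^ 2 / (2 * lam)
        ≤ ‖y - z‖ ^ 2 / (2 * lam) + (h y).toReal + c y := by
  -- `prox` is a choice that means something only if a minimiser exists; existence makes it one.
  have hmin := Classical.epsilon_spec (exists_isMinOn_prox hp hv hc hc0 hlam z)
  change IsMinOn _ Set.univ (prox lam (fun u => h u + (c u : EReal)) z) at hmin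
  rw [hu] at hmin
  have hx₀ := hp.ne_top_of_mem_subdifferential hv
  have hut : h u ≠ ⊤ := by
    intro htop
    have := hmin (Set.mem_univ x₀)
    simp only [Set.mem_ofPred_eq, htop, EReal.top_add_coe, EReal.coe_add_top, top_le_iff] at this
    rw [← hp.coe_toReal hx₀, ← EReal.coe_add, ← EReal.coe_add] at this
    exact EReal.coe_ne_top _ this
  have hreal : ∀ y, h y ≠ ⊤ → ‖u - z‖ ^ 2 / (2 * lam) + ((h u).toReal + c u)
      ≤ ‖y - z‖ ^ 2 / (2 * lam) + ((h y).toReal + c y) := by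
    intro y hy
    have := hmin (Set.mem_univ y)
    simp only [Set.mem_ofPred_eq] at this
    rw [← hp.coe_toReal hut, ← hp.coe_toReal hy, ← EReal.coe_add, ← EReal.coe_add,
      ← EReal.coe_add, ← EReal.coe_add, EReal.coe_le_coe_iff] at this
    exact this
  refine ⟨hut, fun y hy => ?_⟩
  -- Minimality against (1 - s)u + sy, divided by s, yields the strong convexity term with factor 1
  -- - s; then s → 0.
  refine le_of_forall_le_add_mul (c := ‖y - u‖ ^ 2 / (2 * lam)) fun s hs hs1 => ?_
  have hs' : 0 ≤ 1 - s := by linarith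
  have hcv := hp.convexOn_toReal
  have h1 := hcv.2 hut hy hs' hs.le (by ring)
  have h2 := hcc.2 (Set.mem_univ u) (Set.mem_univ y) hs' hs.le (by ring)
  have h3 := hreal _ (hcv.1 hut hy hs' hs.le (by ring))
  rw [norm_combo_sub_sq (by ring), norm_sub_rev u y] at h3
  simp only [smul_eq_mul] at h1 h2
  have h4 : s * (‖u - z‖ ^ 2 / (2 * lam) + (h u).toReal + c u + ‖y - u‖ ^ 2 / (2 * lam))
      ≤ s * (‖y - z‖ ^ 2 / (2 * lam) + (h y).toReal + c y + s * (‖y - u‖ ^ 2 / (2 * lam))) := by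
    have e : ((1 - s) * ‖u - z‖ ^ 2 + s * ‖y - z‖ ^ 2 - (1 - s) * s * ‖y - u‖ ^ 2) / (2 * lam)
        = (1 - s) * (‖u - z‖ ^ 2 / (2 * lam)) + s * (‖y - z‖ ^ 2 / (2 * lam))
          - (1 - s) * s * (‖y - u‖ ^ 2 / (2 * lam)) := by ring
    rw [e] at h3
    linarith
  exact le_of_mul_le_mul_left h4 hs

theorem continuous_hinge (a : ℝ) (b : E d) :
    Continuous fun u : E d => max (a + inner ℝ b u) 0 := by fun_prop

theorem convexOn_hinge (a : ℝ) (b : E d) :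
    ConvexOn ℝ Set.univ fun u : E d => max (a + inner ℝ b u) 0 := by
  refine ConvexOn.sup ⟨convex_univ, fun x _ y _ s t _ _ hst => le_of_eq ?_⟩
    (convexOn_const 0 convex_univ)
  dsimp only
  rw [inner_add_right, inner_smul_right, inner_smul_right, smul_eq_mul, smul_eq_mul]
  obtain rfl : s = 1 - t := by linarith
  ring

/-- The proximal point of `h` plus an affine hinge depends continuously on all parameters. -/
theorem continuous_prox_hinge {X : Type*} [TopologicalSpace X] (hp : IsProperClosedConvex h)
    (hv : v ∈ subdifferential h x₀) {l a : X → ℝ} {b y : X → E d} (hl : Continuous l)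
    (ha : Continuous a) (hb : Continuous b) (hy : Continuous y) (hl0 : ∀ q, 0 < l q) :
    Continuous fun q => prox (l q)
      (fun u => h u + ((max (a q + inner ℝ (b q) u) 0 : ℝ) : EReal)) (y q) := by
  set π : X → E d := fun q => prox (l q)
      (fun u => h u + ((max (a q + inner ℝ (b q) u) 0 : ℝ) : EReal)) (y q) with hπ
  have hspec := fun q => prox_spec hp hv (continuous_hinge (a q) (b q))
    (fun u => le_max_right _ _) (convexOn_hinge (a q) (b q)) (hl0 q) (y q) (u := π q) rfl
  rw [continuous_iff_continuousAt]
  intro q₀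
  set A := π q₀ with hA
  let k : X → ℝ := fun q => 1 / (2 * l q)
  have hk : Continuous k := continuous_const.div (by fun_prop) fun q => by
    have := hl0 q; positivity
  have hk0 : ∀ q, 0 < k q := fun q => by have := hl0 q; positivity
  let e₁ : X → ℝ := fun q => 2 * ‖k q₀ • (A - y q₀) - k q • (A - y q)‖ + ‖b q₀ - b q‖
  let e₂ : X → ℝ := fun q => 2 * |a q₀ - a q| + 2 * (‖b q₀ - b q‖ * ‖A‖)
  -- Each minimiser is tested in the other's three-point inequality. The values of `h` cancel on
  -- addition, so its lack of continuity does no harm, and only parameter differences remain.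
  have hbound : ∀ q, ‖π q - A‖ ^ 2 ≤ e₁ q ^ 2 / (4 * k q ^ 2) + e₂ q / k q := by
    intro q
    set N := ‖π q - A‖ with hN
    have h1 := (hspec q₀).2 (π q) (hspec q).1
    have h2 := (hspec q).2 A (hspec q₀).1
    rw [← hA] at h1
    have hhinge : ∀ u : E d, |max (a q₀ + inner ℝ (b q₀) u) 0 - max (a q + inner ℝ (b q) u) 0|
        ≤ |a q₀ - a q| + ‖b q₀ - b q‖ * ‖u‖ := by
      intro u
      refine (abs_max_sub_max_le_abs _ _ _).trans ?_
      have : a q₀ + inner ℝ (b q₀) u - (a q + inner ℝ (b q) u)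
          = (a q₀ - a q) + inner ℝ (b q₀ - b q) u := by rw [inner_sub_left]; ring
      rw [this]
      exact (abs_add_le _ _).trans (by gcongr; exact abs_real_inner_le_norm _ _)
    have h3 := (abs_le.1 (hhinge (π q))).2
    have h4 := (abs_le.1 (hhinge A)).1
    have h5 : ‖b q₀ - b q‖ * ‖π q‖ ≤ ‖b q₀ - b q‖ * (‖A‖ + N) := by
      gcongr
      exact norm_le_norm_add_norm_sub' _ _
    have e3 : ‖π q - y q₀‖ ^ 2 = N ^ 2 + 2 * inner ℝ (π q - A) (A - y q₀) + ‖A - y q₀‖ ^ 2 := by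
      rw [hN, ← norm_add_sq_real, sub_add_sub_cancel]
    have e4 : ‖π q - y q‖ ^ 2 = N ^ 2 + 2 * inner ℝ (π q - A) (A - y q) + ‖A - y q‖ ^ 2 := by
      rw [hN, ← norm_add_sq_real, sub_add_sub_cancel]
    have h6 : k q₀ * inner ℝ (π q - A) (A - y q₀) - k q * inner ℝ (π q - A) (A - y q)
        ≤ N * ‖k q₀ • (A - y q₀) - k q • (A - y q)‖ := by
      rw [← inner_smul_right, ← inner_smul_right, ← inner_sub_right]
      exact real_inner_le_norm _ _
    rw [norm_sub_rev A (π q)] at h2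
    have hdiv : ∀ q s, s / (2 * l q) = s * k q := fun q s => div_eq_mul_one_div _ _
    simp only [hdiv] at h1 h2
    rw [e3] at h1
    rw [e4] at h2
    have h7 : 2 * k q * N ^ 2 ≤ N * e₁ q + e₂ q := by
      simp only [e₁, e₂]
      linarith
    have hkq := hk0 q
    have h8 : N * e₁ q ≤ k q * N ^ 2 + e₁ q ^ 2 / (4 * k q) := by
      have : k q * N ^ 2 + e₁ q ^ 2 / (4 * k q) - N * e₁ q = k q * (N - e₁ q / (2 * k q)) ^ 2 := by
        field_simp
        ring
      have h9 : 0 ≤ k q * (N - e₁ q / (2 * k q)) ^ 2 := by positivity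
      linarith
    have h10 : k q * N ^ 2 ≤ k q * (e₁ q ^ 2 / (4 * k q ^ 2) + e₂ q / k q) := by
      have : k q * (e₁ q ^ 2 / (4 * k q ^ 2) + e₂ q / k q) = e₁ q ^ 2 / (4 * k q) + e₂ q := by
        field_simp
      linarith
    exact le_of_mul_le_mul_left h10 hkq
  have hlim : Filter.Tendsto (fun q => e₁ q ^ 2 / (4 * k q ^ 2) + e₂ q / k q) (nhds q₀)
      (nhds 0) := by
    have hcont : Continuous fun q => e₁ q ^ 2 / (4 * k q ^ 2) + e₂ q / k q := by
      have he1 : Continuous e₁ := by fun_prop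
      have he2 : Continuous e₂ := by fun_prop
      refine (Continuous.div (by fun_prop) (by fun_prop) fun q => ?_).add
        (he2.div hk fun q => (hk0 q).ne')
      have := hk0 q
      positivity
    have := hcont.tendsto q₀
    simpa [e₁, e₂] using this
  rw [ContinuousAt, tendsto_iff_norm_sub_tendsto_zero]
  have hsq : Filter.Tendsto (fun q => ‖π q - A‖ ^ 2) (nhds q₀) (nhds 0) :=
    squeeze_zero (fun q => by positivity) hbound hlim
  have := hsq.sqrt
  simpa [Real.sqrt_sq] using this

end Prox

/-- Absorbing γ ≥ 0 into the hinge gives the form required by `continuous_prox_hinge`, with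
coefficients continuous in `z` and `w`. -/
theorem linPenalty_eq_hinge {d : ℕ} (h : E d → EReal) (g : E d → ℝ) {γ : ℝ} (hγ : 0 ≤ γ)
    (w : E d) : linPenalty h g γ w = fun u => h u +
      ((max (γ * (g w - inner ℝ (gradient g w) w) + inner ℝ (γ • gradient g w) u) 0 : ℝ) :
        EReal) := by
  funext u
  rw [linPenalty, mul_max_of_nonneg _ _ hγ, mul_zero, inner_sub_right, real_inner_smul_left]
  congr 4
  ring

/-! ### Step sizes, the inner loop and the deterministic one-step bound. -/

/-- Half the harmonic mean of `μ` and `Lf`: the contraction rate of a gradient step. -/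
noncomputable def Params.rate (p : Params) : ℝ := p.μ * p.Lf / (p.μ + p.Lf)

namespace Assumptions

variable {d m : ℕ} {Ξ : Type*} [MeasurableSpace Ξ] {Q : Problem d m Ξ} {P : Measure Ξ}
  {p : Params} {r B σ G Bt : ℝ} {xs xt : E d}

theorem η_pos (H : Assumptions Q P p r B σ G Bt xs xt) (t : ℕ) : 0 < p.η t := by
  have h1 := H.μ_pos
  have h2 := H.Lf_pos
  rw [Params.η]
  positivity

theorem η_mul_le (H : Assumptions Q P p r B σ G Bt xs xt) (t : ℕ) :
    p.η t * (p.μ + p.Lf) ≤ 1 / 4 := by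
  have h1 := H.μ_pos
  have h2 := H.Lf_pos
  rw [Params.η, div_mul_eq_mul_div, div_le_iff₀ (by positivity)]
  have : 0 ≤ p.μ * p.Lf * t := by positivity
  nlinarith

theorem η_mul_Lf_le (H : Assumptions Q P p r B σ G Bt xs xt) (t : ℕ) :
    p.η t * p.Lf ≤ 1 / 4 := by
  have h1 := H.η_mul_le t
  have h2 := mul_pos (H.η_pos t) H.μ_pos
  linarith

theorem κ_ge (H : Assumptions Q P p r B σ G Bt xs xt) : 1 ≤ p.κ := by
  rw [Params.κ, one_le_div H.μ_pos]
  exact H.μ_le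

theorem rate_pos (H : Assumptions Q P p r B σ G Bt xs xt) : 0 < p.rate := by
  have h1 := H.μ_pos
  have h2 := H.Lf_pos
  rw [Params.rate]
  positivity

theorem rate_le (H : Assumptions Q P p r B σ G Bt xs xt) : p.rate ≤ p.μ := by
  have h1 := H.μ_pos
  have h2 := H.Lf_pos
  rw [Params.rate, div_le_iff₀ (by positivity)]
  nlinarith

/-- The inner accuracy is of the order of the outer step size. -/
theorem two_le_rate_mul_η (H : Assumptions Q P p r B σ G Bt xs xt) (t : ℕ) :
    2 ≤ p.rate * p.η t * ((t + 32) * (1 + p.κ)) := by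
  have h1 := H.μ_pos
  have h2 := H.Lf_pos
  have h3 := H.μ_le
  have e : p.rate * p.η t * ((t + 32) * (1 + p.κ))
      = 2 * (p.Lf * (t + 32) * (p.μ + p.Lf)) / (p.μ * p.Lf * t + 8 * (p.μ + p.Lf) ^ 2) := by
    rw [Params.rate, Params.η, Params.κ]
    field_simp
  rw [e, le_div_iff₀ (by positivity)]
  have h4 : 0 ≤ p.Lf ^ 2 * t := by positivity
  nlinarith

theorem γ_nonneg (H : Assumptions Q P p r B σ G Bt xs xt) (t : ℕ) (z : E d) :
    0 ≤ p.γ xt t z := by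
  have h1 := H.η_pos t
  have h2 := H.ν_pos
  rw [Params.γ]
  positivity

/-- The calibration behind `infDist_sq_le`: removing a violation s by moving towards `xt` costs at
most (s/ν)‖z - xt‖², and this equals 2ηγs. -/
theorem two_mul_η_mul_γ (H : Assumptions Q P p r B σ G Bt xs xt) (t : ℕ) (z : E d) :
    2 * p.η t * p.γ xt t z * p.ν = ‖z - xt‖ ^ 2 := by
  have h1 := H.η_pos t
  have h2 := H.ν_pos
  rw [Params.γ]
  field_simp

theorem β_pos (H : Assumptions Q P p r B σ G Bt xs xt) (z : E d) : 0 < p.β xt z := by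
  have h1 := H.Lg_nonneg
  have h2 := H.ν_pos
  rw [Params.β]
  positivity

theorem β_le (H : Assumptions Q P p r B σ G Bt xs xt) (z : E d) : p.β xt z ≤ 1 := by
  have h1 := H.Lg_nonneg
  have h2 := H.ν_pos
  rw [Params.β, div_le_one (by positivity)]
  have : 0 ≤ p.Lg * ‖z - xt‖ ^ 2 := by positivity
  linarith

/-- The defining equation of β: the curvature error βηγLg‖u - w‖² of the linearised constraint
equals the term (1 - β)‖u - w‖² available in the inner step. -/
theorem one_sub_β (H : Assumptions Q P p r B σ G Bt xs xt) (t : ℕ) (z : E d) :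
    1 - p.β xt z = p.β xt z * p.η t * p.γ xt t z * p.Lg := by
  have h1 := H.Lg_nonneg
  have h2 := H.ν_pos
  have h3 := H.η_pos t
  have h4 := H.two_mul_η_mul_γ t z
  have h5 : 0 < 2 * p.ν + p.Lg * ‖z - xt‖ ^ 2 := by positivity
  rw [Params.β, eq_comm, ← sub_eq_zero]
  field_simp
  rw [← h4]
  ring

theorem β_mul (H : Assumptions Q P p r B σ G Bt xs xt) (z : E d) :
    p.β xt z * (1 + p.Lg / (2 * p.ν) * ‖z - xt‖ ^ 2) = 1 := by
  have h1 := H.Lg_nonneg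
  have h2 := H.ν_pos
  rw [Params.β]
  field_simp

/-- The inner loop is long enough: its total contraction is at most
`((t + 32)(1 + κ))^(-1/2)`. -/
theorem contraction_sq_mul_le (H : Assumptions Q P p r B σ G Bt xs xt) (t : ℕ) (z : E d) :
    ((1 - p.β xt z) ^ p.τ xt t z) ^ 2 * ((t + 32) * (1 + p.κ)) ≤ 1 := by
  have hκ := H.κ_ge
  set X : ℝ := (t + 32) * (1 + p.κ) with hX
  have hX0 : 0 < X := by positivity
  have hβ0 := H.β_pos z
  have hβ1 := H.β_le z
  have h1 : 1 / 2 * Real.log X * (1 + p.Lg / (2 * p.ν) * ‖z - xt‖ ^ 2) ≤ p.τ xt t z :=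
    Nat.le_ceil _
  have h2 : 1 / 2 * Real.log X ≤ p.β xt z * p.τ xt t z := by
    calc 1 / 2 * Real.log X
        = p.β xt z * (1 / 2 * Real.log X * (1 + p.Lg / (2 * p.ν) * ‖z - xt‖ ^ 2)) := by
          rw [mul_left_comm, H.β_mul, mul_one]
      _ ≤ _ := by gcongr
  have h3 : (1 - p.β xt z) ^ p.τ xt t z ≤ Real.exp (-(1 / 2 * Real.log X)) := by
    calc (1 - p.β xt z) ^ p.τ xt t z ≤ Real.exp (-p.β xt z) ^ p.τ xt t z :=
          pow_le_pow_left₀ (by linarith) (Real.one_sub_le_exp_neg _) _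
      _ = Real.exp (-(p.β xt z * p.τ xt t z)) := by rw [← Real.exp_nat_mul]; ring_nf
      _ ≤ _ := by gcongr
  have h4 : 0 ≤ (1 - p.β xt z) ^ p.τ xt t z := pow_nonneg (by linarith) _
  calc ((1 - p.β xt z) ^ p.τ xt t z) ^ 2 * X
      ≤ Real.exp (-(1 / 2 * Real.log X)) ^ 2 * X := by gcongr
    _ = Real.exp (-Real.log X) * X := by rw [← Real.exp_nat_mul]; push_cast; ring_nf
    _ = 1 := by rw [Real.exp_neg, Real.exp_log hX0, inv_mul_cancel₀ (ne_of_gt hX0)]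

/-- One inner step contracts towards the solution up to the value gap of the subproblem. -/
theorem innerStep_spec (H : Assumptions Q P p r B σ G Bt xs xt) (t : ℕ) (j : Fin m) (z w : E d)
    {u : E d} (hu : innerStep Q p xt t j z w = u) :
    Q.h u ≠ ⊤ ∧ ‖u - xs‖ ^ 2 ≤ (1 - p.β xt z) * ‖w - xs‖ ^ 2 + p.β xt z *
      (‖z - xs‖ ^ 2 - ‖u - z‖ ^ 2 - 2 * p.η t * p.γ xt t z * max (Q.g j u) 0
        + 2 * p.η t * ((Q.h xs).toReal - (Q.h u).toReal)) := by
  obtain ⟨v, hv, -⟩ := H.grads.2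
  have hη := H.η_pos t
  have hβ := H.β_pos z
  have hγ := H.γ_nonneg t z
  set β := p.β xt z
  set γ := p.γ xt t z
  set η := p.η t
  have hcont : Continuous fun u => γ * max (Q.g j w + inner ℝ (gradient (Q.g j) w) (u - w)) 0 := by
    fun_prop
  have hconv : ConvexOn ℝ Set.univ
      fun u => γ * max (Q.g j w + inner ℝ (gradient (Q.g j) w) (u - w)) 0 := by
    have := (convexOn_hinge (Q.g j w - inner ℝ (gradient (Q.g j) w) w)
      (gradient (Q.g j) w)).smul hγ
    refine this.congr fun u _ => ?_
    simp only [smul_eq_mul, inner_sub_right]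
    ring_nf
  obtain ⟨hut, h3⟩ := prox_spec H.smooth.h_pcc hv hcont
    (fun u => mul_nonneg hγ (le_max_right _ _)) hconv (mul_pos hβ hη)
    ((1 - β) • w + β • z) (u := u) hu
  refine ⟨hut, ?_⟩
  have h4 := h3 xs H.h_xs
  have hlin : max (Q.g j w + inner ℝ (gradient (Q.g j) w) (xs - w)) 0 = 0 := by
    refine max_eq_right ?_
    have h5 := add_inner_gradient_le (H.smooth.g_convex j) (H.smooth.g_smooth j).1 w xs
    have h6 : Q.g j xs ≤ 0 := Set.mem_iInter.1 H.sol.1 j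
    linarith
  have hmaj : max (Q.g j u) 0 ≤ max (Q.g j w + inner ℝ (gradient (Q.g j) w) (u - w)) 0
      + p.Lg / 2 * ‖u - w‖ ^ 2 := by
    have h5 := (H.smooth.g_smooth j).le_add w u
    have h6 : 0 ≤ p.Lg / 2 * ‖u - w‖ ^ 2 := by have := H.Lg_nonneg; positivity
    refine max_le ?_ ?_
    · linarith [le_max_left (Q.g j w + inner ℝ (gradient (Q.g j) w) (u - w)) 0]
    · linarith [le_max_right (Q.g j w + inner ℝ (gradient (Q.g j) w) (u - w)) 0]
  -- Expanding both distances to the centre (1 - β)w + βz produces the same term in ‖w - z‖² on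
  -- either side, which cancels.
  rw [hlin, mul_zero, add_zero, norm_sub_rev u, norm_sub_rev xs (_ + _),
    norm_combo_sub_sq (by ring), norm_combo_sub_sq (by ring), norm_sub_rev xs u,
    norm_sub_rev w u, norm_sub_rev z u] at h4
  set ℓ := max (Q.g j w + inner ℝ (gradient (Q.g j) w) (u - w)) 0
  have hβη : 0 < 2 * (β * η) := by positivity
  have h5 := mul_le_mul_of_nonneg_left h4 hβη.le
  have e1 : ∀ a b c e : ℝ, 2 * (β * η) * (a / (2 * (β * η)) + b + c + e / (2 * (β * η)))
      = a + e + 2 * (β * η) * (b + c) := by intro a b c e; field_simp; ring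
  have e2 : ∀ a b : ℝ, 2 * (β * η) * (a / (2 * (β * η)) + b) = a + 2 * (β * η) * b := by
    intro a b; field_simp
  rw [e1, e2] at h5
  have h6 : 2 * (β * η * γ) * max (Q.g j u) 0
      ≤ 2 * (β * η * γ) * (ℓ + p.Lg / 2 * ‖u - w‖ ^ 2) := by gcongr
  have h7 : (1 - β) * ‖u - w‖ ^ 2 = 2 * (β * η * γ) * (p.Lg / 2 * ‖u - w‖ ^ 2) := by
    rw [H.one_sub_β t z]; ring
  linarith

/-- The penalised distance to a trial point controls the distance to the constraint set. -/
theorem infDist_sq_le (H : Assumptions Q P p r B σ G Bt xs xt) (t : ℕ) (j : Fin m) (z u : E d) :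
    Metric.infDist z (Q.constraintSet j) ^ 2
      ≤ ‖u - z‖ ^ 2 + 2 * p.η t * p.γ xt t z * max (Q.g j u) 0 := by
  have hν := H.ν_pos
  set s := max (Q.g j u) 0 with hs
  have hs0 : 0 ≤ s := le_max_right _ _
  -- The weight at which the convexity bound (1 - θ)s - θν of the constraint vanishes.
  set θ := s / (s + p.ν) with hθ
  have hsν : 0 < s + p.ν := by linarith
  have hθ0 : 0 ≤ θ := by positivity
  have hθ1 : 1 - θ = p.ν / (s + p.ν) := by rw [hθ]; field_simp; ring
  have hθ1' : 0 ≤ 1 - θ := by rw [hθ1]; positivity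
  have hmem : (1 - θ) • u + θ • xt ∈ Q.constraintSet j := by
    have h1 := (H.smooth.g_convex j).2 (Set.mem_univ u) (Set.mem_univ xt) hθ1' hθ0 (by ring)
    refine h1.trans ?_
    simp only [smul_eq_mul]
    have h2 : (1 - θ) * Q.g j u ≤ (1 - θ) * s := by gcongr; exact le_max_left _ _
    have h3 : θ * Q.g j xt ≤ θ * (-p.ν) := by gcongr; exact H.slater.1 j
    have h4 : (1 - θ) * s + θ * (-p.ν) = 0 := by rw [hθ1, hθ]; ring
    linarith
  have h1 := Metric.infDist_le_dist_of_mem (x := z) hmem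
  rw [dist_comm, dist_eq_norm] at h1
  have h2 : θ ≤ s / p.ν := by
    rw [hθ]; gcongr; linarith
  have h5 : 0 ≤ (1 - θ) * θ * ‖u - xt‖ ^ 2 := by positivity
  calc _ ≤ ‖(1 - θ) • u + θ • xt - z‖ ^ 2 := by gcongr; exact Metric.infDist_nonneg
    _ ≤ (1 - θ) * ‖u - z‖ ^ 2 + θ * ‖xt - z‖ ^ 2 := by
      rw [norm_combo_sub_sq (by ring)]; linarith
    _ ≤ 1 * ‖u - z‖ ^ 2 + s / p.ν * ‖xt - z‖ ^ 2 := by gcongr; linarith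
    _ = _ := by
      rw [norm_sub_rev xt z, ← H.two_mul_η_mul_γ t z]
      field_simp

theorem norm_gradient_mean_sq_le (H : Assumptions Q P p r B σ G Bt xs xt) :
    ‖gradient (Q.mean P) xs‖ ^ 2 ≤ B := by
  obtain ⟨v, -, hv⟩ := H.grads.2
  linarith [sq_nonneg ‖v‖]

/-- The inner loop averages the initial error and the value gap bound. -/
theorem iterate_innerStep_le (H : Assumptions Q P p r B σ G Bt xs xt) (t : ℕ) (j : Fin m)
    (z x : E d) {R : ℝ} (hR : ∀ u, Q.h u ≠ ⊤ →
      ‖z - xs‖ ^ 2 - ‖u - z‖ ^ 2 - 2 * p.η t * p.γ xt t z * max (Q.g j u) 0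
        + 2 * p.η t * ((Q.h xs).toReal - (Q.h u).toReal) ≤ R) (k : ℕ) :
    ‖(innerStep Q p xt t j z)^[k] x - xs‖ ^ 2
      ≤ (1 - p.β xt z) ^ k * ‖x - xs‖ ^ 2 + (1 - (1 - p.β xt z) ^ k) * R := by
  have hβ0 := H.β_pos z
  have hβ1 := H.β_le z
  induction k with
  | zero => simp
  | succ k ih =>
    rw [Function.iterate_succ_apply']
    obtain ⟨h1, h2⟩ := H.innerStep_spec t j z ((innerStep Q p xt t j z)^[k] x) rfl
    have h3 := mul_le_mul_of_nonneg_left (hR _ h1) hβ0.le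
    have h4 := mul_le_mul_of_nonneg_left ih (by linarith : 0 ≤ 1 - p.β xt z)
    exact (h2.trans (add_le_add h4 h3)).trans (le_of_eq (by ring))

variable [IsProbabilityMeasure P]

/-- Uniform bound on the value gap of the subproblem after a gradient step with gradient `n`. -/
theorem value_gap_le (H : Assumptions Q P p r B σ G Bt xs xt) (t : ℕ) (j : Fin m) (x n : E d)
    {u : E d} (hu : Q.h u ≠ ⊤) {z : E d} (hz : z = x - p.η t • n) :
    ‖z - xs‖ ^ 2 - ‖u - z‖ ^ 2 - 2 * p.η t * p.γ xt t z * max (Q.g j u) 0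
        + 2 * p.η t * ((Q.h xs).toReal - (Q.h u).toReal)
      ≤ ‖x - xs‖ ^ 2 - 2 * p.η t * inner ℝ (n - gradient (Q.mean P) xs) (x - xs)
        + 3 / 2 * p.η t ^ 2 * ‖n‖ ^ 2
        + 2 * p.η t * penaltySlope r G Bt p.ν p.Lg * Metric.infDist x Q.feasibleSet
        - 1 / 8 * Metric.infDist x (Q.constraintSet j) ^ 2
        + p.η t ^ 2 * (12 * penaltySlope r G Bt p.ν p.Lg ^ 2 + 10 * B) := by
  have hη := H.η_pos t
  have hK := H.penaltySlope_nonneg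
  have hpen := H.neg_penalty_le_linGap hu
  have hj := H.infDist_sq_le t j z u
  have hB := H.norm_gradient_mean_sq_le
  have hmax : 0 ≤ 2 * p.η t * p.γ xt t z * max (Q.g j u) 0 :=
    mul_nonneg (mul_nonneg (by positivity) (H.γ_nonneg t z)) (le_max_right _ _)
  set K := penaltySlope r G Bt p.ν p.Lg
  set η := p.η t
  set gF := gradient (Q.mean P) xs
  have hzx : ‖x - z‖ = η * ‖n‖ := by
    rw [hz, sub_sub_cancel, norm_smul, Real.norm_of_nonneg hη.le]
  have e1 : ‖z - xs‖ ^ 2 = ‖x - xs‖ ^ 2 - 2 * η * inner ℝ n (x - xs) + η ^ 2 * ‖n‖ ^ 2 := by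
    have : z - xs = (x - xs) - η • n := by rw [hz]; abel
    rw [this, norm_sub_sq_real, inner_smul_right, real_inner_comm, norm_smul,
      Real.norm_of_nonneg hη.le]
    ring
  -- The part along `x - xs` recentres the stochastic gradient at ∇F(x⋆); the other two are of
  -- second order.
  have e2 : (inner ℝ gF (u - xs) : ℝ)
      = inner ℝ gF (x - xs) - η * inner ℝ gF n + inner ℝ gF (u - z) := by
    have : u - xs = (x - xs) - η • n + (u - z) := by rw [hz]; abel
    rw [this, inner_add_right, inner_sub_right, inner_smul_right]
  have hcs : ∀ a b : E d, ∀ c : ℝ, 0 < c →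
      (inner ℝ a b : ℝ) ≤ c * ‖a‖ ^ 2 + 1 / (4 * c) * ‖b‖ ^ 2 := by
    intro a b c hc
    refine (real_inner_le_norm a b).trans ?_
    have : c * ‖a‖ ^ 2 + 1 / (4 * c) * ‖b‖ ^ 2 - ‖a‖ * ‖b‖ = c * (‖a‖ - ‖b‖ / (2 * c)) ^ 2 := by
      field_simp
      ring
    have h2 : 0 ≤ c * (‖a‖ - ‖b‖ / (2 * c)) ^ 2 := by positivity
    linarith
  -- Budget for -‖u - z‖²: a half is spent here and a quarter in `i3`. The last quarter, with a
  -- quarter of the penalty, bounds dist(z, X_j)²/4 and through `d2` gives dist(x, X_j)²/8. The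
  -- terms η²‖n‖² add up to 1 + 1/8 + 1/8 + 1/4 = 3/2.
  have i1 : 2 * η * (inner ℝ gF (u - z) : ℝ) ≤ 2 * η ^ 2 * B + 1 / 2 * ‖u - z‖ ^ 2 := by
    have h1 := hcs (η • gF) (u - z) 1 one_pos
    rw [real_inner_smul_left, norm_smul, Real.norm_of_nonneg hη.le, mul_pow] at h1
    have h2 : η ^ 2 * ‖gF‖ ^ 2 ≤ η ^ 2 * B := by gcongr
    linarith
  have i2 : -(2 * η ^ 2 * (inner ℝ gF n : ℝ)) ≤ 8 * η ^ 2 * B + 1 / 8 * η ^ 2 * ‖n‖ ^ 2 := by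
    have h1 := hcs gF (-n) 4 (by norm_num)
    rw [inner_neg_right, norm_neg] at h1
    have h3 : η ^ 2 * -(inner ℝ gF n : ℝ) ≤ η ^ 2 * (4 * B + 1 / (4 * 4) * ‖n‖ ^ 2) := by
      gcongr
      linarith
    linarith
  have d1 : Metric.infDist u Q.feasibleSet
      ≤ Metric.infDist x Q.feasibleSet + η * ‖n‖ + ‖u - z‖ := by
    have h1 := Metric.infDist_le_infDist_add_dist (s := Q.feasibleSet) (x := u) (y := x)
    have h2 := dist_triangle_right u x z
    rw [dist_eq_norm u z, dist_eq_norm x z, hzx] at h2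
    linarith
  have i3 : 2 * η * (K * Metric.infDist u Q.feasibleSet)
      ≤ 2 * η * K * Metric.infDist x Q.feasibleSet + 1 / 8 * η ^ 2 * ‖n‖ ^ 2
        + 1 / 4 * ‖u - z‖ ^ 2 + 12 * η ^ 2 * K ^ 2 := by
    have h1 : 2 * η * (K * Metric.infDist u Q.feasibleSet)
        ≤ 2 * η * (K * (Metric.infDist x Q.feasibleSet + η * ‖n‖ + ‖u - z‖)) := by gcongr
    have h2 := sq_nonneg (1 / 2 * ‖u - z‖ - 2 * η * K)
    have h3 := mul_nonneg (sq_nonneg η) (sq_nonneg (‖n‖ - 8 * K))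
    nlinarith
  have d2 : Metric.infDist x (Q.constraintSet j) ^ 2
      ≤ 2 * Metric.infDist z (Q.constraintSet j) ^ 2 + 2 * η ^ 2 * ‖n‖ ^ 2 := by
    have h1 := Metric.infDist_le_infDist_add_dist (s := Q.constraintSet j) (x := x) (y := z)
    rw [dist_eq_norm, hzx] at h1
    have h2 : Metric.infDist x (Q.constraintSet j) ^ 2
        ≤ (Metric.infDist z (Q.constraintSet j) + η * ‖n‖) ^ 2 := by
      gcongr; exact Metric.infDist_nonneg
    have h3 := sq_nonneg (Metric.infDist z (Q.constraintSet j) - η * ‖n‖)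
    linarith
  have i4 : 2 * η * ((Q.h xs).toReal - (Q.h u).toReal)
      ≤ 2 * η * (inner ℝ gF (u - xs) + K * Metric.infDist u Q.feasibleSet) := by
    gcongr
    rw [Problem.linGap] at hpen
    linarith
  rw [e2] at i4
  rw [e1, inner_sub_left]
  linarith

/-- Deterministic one-step bound for the outer loop. -/
theorem outerStep_le (H : Assumptions Q P p r B σ G Bt xs xt) (t : ℕ) (ξ : Ξ) (j : Fin m)
    (x : E d) :
    ‖outerStep Q p xt t ξ j x - xs‖ ^ 2 ≤
      (1 + p.rate * p.η t / 16) * ‖x - xs‖ ^ 2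
        - 35 / 32 * p.η t * inner ℝ (gradient (Q.f ξ) x - gradient (Q.f ξ) xs) (x - xs)
        - 2 * p.η t * inner ℝ (gradient (Q.f ξ) xs - gradient (Q.mean P) xs) (x - xs)
        + 14 * p.η t ^ 2 * ‖gradient (Q.f ξ) xs - gradient (Q.mean P) xs‖ ^ 2
        + (2 * p.η t * penaltySlope r G Bt p.ν p.Lg * Metric.infDist x Q.feasibleSet
        - 7 / 64 * Metric.infDist x (Q.constraintSet j) ^ 2
        + p.η t ^ 2 * (12 * penaltySlope r G Bt p.ν p.Lg ^ 2 + 16 * B)) := by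
  have hη := H.η_pos t
  have hηL := H.η_mul_Lf_le t
  have hK := H.penaltySlope_nonneg
  have hB := H.norm_gradient_mean_sq_le
  have ha := H.rate_pos
  have hX := H.two_le_rate_mul_η t
  have hκ := H.κ_ge
  set z := gradStep Q p t ξ x with hz
  have hβ0 := H.β_pos z
  have hβ1 := H.β_le z
  have hq := H.contraction_sq_mul_le t z
  have hstep := H.iterate_innerStep_le t j z x
    (fun u hu => H.value_gap_le t j x (gradient (Q.f ξ) x) hu hz) (p.τ xt t z)
  have hq0 : 0 ≤ (1 - p.β xt z) ^ p.τ xt t z := pow_nonneg (by linarith) _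
  rw [outerStep, ← hz]
  refine hstep.trans ?_
  have hco := norm_gradient_sub_sq_le (H.smooth.f_convex ξ) (H.smooth.f_smooth ξ) H.Lf_pos x xs
  set q := (1 - p.β xt z) ^ p.τ xt t z
  set K := penaltySlope r G Bt p.ν p.Lg
  set η := p.η t
  set a := p.rate
  set n := gradient (Q.f ξ) x
  set s := gradient (Q.f ξ) xs
  set gF := gradient (Q.mean P) xs
  set X : ℝ := (t + 32) * (1 + p.κ) with hXdef
  have hX64 : 64 ≤ X := by
    have : (0 : ℝ) ≤ t := t.cast_nonneg
    rw [hXdef]; nlinarith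
  have hq8 : q ≤ 1 / 8 := by
    have h1 : q ^ 2 * 64 ≤ q ^ 2 * X := by gcongr
    nlinarith
  have hqa : 2 * q ^ 2 ≤ a * η := by
    have h1 : 2 * q ^ 2 * X ≤ a * η * X := by linarith
    exact le_of_mul_le_mul_right h1 (by linarith)
  set I : ℝ := inner ℝ (n - s) (x - xs)
  set J : ℝ := inner ℝ (s - gF) (x - xs) with hJ
  have hI : 0 ≤ I := by
    have h1 := H.Lf_pos
    exact nonneg_of_mul_nonneg_right ((sq_nonneg _).trans hco) h1
  have hIJ : (inner ℝ (n - gF) (x - xs) : ℝ) = I + J := by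
    rw [← inner_add_left, sub_add_sub_cancel]
  -- Cocoercivity and ηL_f ≤ 1/4 charge the variable part of the gradient to `I`, so noise enters
  -- only through its value at the solution.
  have hn : 3 / 2 * η ^ 2 * ‖n‖ ^ 2 ≤ 3 / 4 * η * I + 6 * η ^ 2 * ‖s - gF‖ ^ 2 + 6 * η ^ 2 * B := by
    have h1 : ‖n‖ ^ 2 ≤ 2 * ‖n - s‖ ^ 2 + 4 * ‖s - gF‖ ^ 2 + 4 * ‖gF‖ ^ 2 := by
      have e : n = (n - s) + ((s - gF) + gF) := by abel
      have h2 : ‖n‖ ≤ ‖n - s‖ + (‖s - gF‖ + ‖gF‖) := by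
        conv_lhs => rw [e]
        exact (norm_add_le _ _).trans (by gcongr; exact norm_add_le _ _)
      have h3 : ‖n‖ ^ 2 ≤ (‖n - s‖ + (‖s - gF‖ + ‖gF‖)) ^ 2 := by gcongr
      linarith [sq_nonneg (‖n - s‖ - (‖s - gF‖ + ‖gF‖)), sq_nonneg (‖s - gF‖ - ‖gF‖)]
    have h2 : η ^ 2 * ‖n - s‖ ^ 2 ≤ 1 / 4 * (η * I) := by
      calc η ^ 2 * ‖n - s‖ ^ 2 ≤ η ^ 2 * (p.Lf * I) := by gcongr
        _ = η * p.Lf * (η * I) := by ring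
        _ ≤ _ := by gcongr
    have h3 : η ^ 2 * ‖n‖ ^ 2 ≤ η ^ 2 * (2 * ‖n - s‖ ^ 2 + 4 * ‖s - gF‖ ^ 2 + 4 * B) := by
      gcongr
      linarith
    linarith
  -- `q` depends on the sample, so `q * J` has no reason to average to zero. Young's inequality and
  -- 2q² ≤ aη reduce it to a small multiple of the error plus O(η²) noise.
  have hqJ : 2 * q * η * J ≤ a * η / 16 * ‖x - xs‖ ^ 2 + 8 * η ^ 2 * ‖s - gF‖ ^ 2 := by
    have h1 : J ≤ ‖s - gF‖ * ‖x - xs‖ := real_inner_le_norm _ _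
    have h2 := sq_nonneg (a * ‖x - xs‖ / 4 - 4 * q * ‖s - gF‖)
    have h3 : 2 * q ^ 2 * ‖s - gF‖ ^ 2 ≤ a * η * ‖s - gF‖ ^ 2 := by gcongr
    have h4 : a * (2 * q * (‖s - gF‖ * ‖x - xs‖))
        ≤ a * (a / 16 * ‖x - xs‖ ^ 2 + 8 * η * ‖s - gF‖ ^ 2) := by linarith
    have h5 := le_of_mul_le_mul_left h4 ha
    calc 2 * q * η * J ≤ 2 * q * η * (‖s - gF‖ * ‖x - xs‖) := by gcongr
      _ = η * (2 * q * (‖s - gF‖ * ‖x - xs‖)) := by ring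
      _ ≤ η * (a / 16 * ‖x - xs‖ ^ 2 + 8 * η * ‖s - gF‖ ^ 2) := by gcongr
      _ = _ := by ring
  rw [hIJ]
  set D := Metric.infDist x Q.feasibleSet
  have hD : 0 ≤ D := Metric.infDist_nonneg
  set D' := Metric.infDist x (Q.constraintSet j)
  have hB0 : 0 ≤ B := (sq_nonneg _).trans hB
  have hq1 : 0 ≤ 1 - q := by linarith
  -- From q ≤ 1/8 come the constants 35/32 = 7/8 · (2 - 3/4) and 7/64 = 7/8 · 1/8; the noise
  -- coefficient is 14 = 6 + 8.
  have c1 : (1 - q) * (3 / 2 * η ^ 2 * ‖n‖ ^ 2)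
      ≤ (1 - q) * (3 / 4 * η * I + 6 * η ^ 2 * ‖s - gF‖ ^ 2 + 6 * η ^ 2 * B) := by gcongr
  have c2 : 7 / 8 * (5 / 4 * η * I) ≤ (1 - q) * (5 / 4 * η * I) := by
    gcongr; linarith
  have c3 : 7 / 8 * (1 / 8 * D' ^ 2) ≤ (1 - q) * (1 / 8 * D' ^ 2) := by
    gcongr; linarith
  have c4 : 0 ≤ q * (2 * η * K * D + 6 * η ^ 2 * ‖s - gF‖ ^ 2 + 6 * η ^ 2 * B
      + η ^ 2 * (12 * K ^ 2 + 10 * B)) := by positivity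
  linarith

end Assumptions

/-! ### Measurability of the outer step and the one-step bound in expectation. -/

/-- The noise level of the outer recursion. -/
noncomputable def noiseLevel (r B σ G Bt ν Lg : ℝ) : ℝ :=
  12 * penaltySlope r G Bt ν Lg ^ 2 + 16 * B + 14 * σ ^ 2 + 10 * penaltySlope r G Bt ν Lg ^ 2 / r

namespace Assumptions

variable {d m : ℕ} {Ξ : Type*} [MeasurableSpace Ξ] {Q : Problem d m Ξ} {P : Measure Ξ}
  {p : Params} {r B σ G Bt : ℝ} {xs xt : E d}

section Measurability

theorem continuous_innerStep (H : Assumptions Q P p r B σ G Bt xs xt) (t : ℕ) (j : Fin m) :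
    Continuous fun q : E d × E d => innerStep Q p xt t j q.1 q.2 := by
  obtain ⟨v, hv, -⟩ := H.grads.2
  have hβ : Continuous fun q : E d × E d => p.β xt q.1 := by
    refine continuous_const.div (by fun_prop) fun q => ?_
    have h1 := H.Lg_nonneg
    have h2 := H.ν_pos
    positivity
  have hγ : Continuous fun q : E d × E d => p.γ xt t q.1 := by
    simp only [Params.γ]
    fun_prop
  have hg : Continuous (Q.g j) := (H.smooth.g_smooth j).1.continuous
  have hG : Continuous (gradient (Q.g j)) := (H.smooth.g_smooth j).continuous_gradient
  have := continuous_prox_hinge (X := E d × E d) H.smooth.h_pcc hv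
    (l := fun q => p.β xt q.1 * p.η t)
    (a := fun q => p.γ xt t q.1 * (Q.g j q.2 - inner ℝ (gradient (Q.g j) q.2) q.2))
    (b := fun q => p.γ xt t q.1 • gradient (Q.g j) q.2)
    (y := fun q => (1 - p.β xt q.1) • q.2 + p.β xt q.1 • q.1)
    (by fun_prop) (by fun_prop) (by fun_prop) (by fun_prop)
    (fun q => mul_pos (H.β_pos q.1) (H.η_pos t))
  refine this.congr fun q => ?_
  rw [innerStep, linPenalty_eq_hinge _ _ (H.γ_nonneg t q.1)]

theorem measurable_iterate_innerStep (H : Assumptions Q P p r B σ G Bt xs xt) (t : ℕ) (j : Fin m)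
    (k : ℕ) : Measurable fun q : E d × E d => (innerStep Q p xt t j q.1)^[k] q.2 := by
  induction k with
  | zero => exact measurable_snd
  | succ k ih =>
    simp only [Function.iterate_succ_apply']
    exact Measurable.comp (g := fun q : E d × E d => innerStep Q p xt t j q.1 q.2)
      (f := fun q : E d × E d => (q.1, (innerStep Q p xt t j q.1)^[k] q.2))
      (H.continuous_innerStep t j).measurable (measurable_fst.prodMk ih)

theorem measurable_gradStep (H : Assumptions Q P p r B σ G Bt xs xt) (t : ℕ) :
    Measurable fun q : E d × Ξ => gradStep Q p t q.2 q.1 :=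
  measurable_fst.sub ((measurable_uncurry_gradient H.stoch H.smooth).const_smul (p.η t))

theorem measurable_τ (p : Params) (xt : E d) (t : ℕ) : Measurable (p.τ xt t) := by
  refine Nat.measurable_ceil.comp ?_
  fun_prop

/-- The number of inner steps is random, but it and `j` take countably many values, so joint
measurability reduces to fixed values of both. -/
theorem measurable_outerStep (H : Assumptions Q P p r B σ G Bt xs xt) (t : ℕ) :
    Measurable fun q : E d × Ξ × Fin m => outerStep Q p xt t q.2.1 q.2.2 q.1 := by
  have h1 : Measurable fun q : (E d × E d) × ℕ × Fin m =>
      (innerStep Q p xt t q.2.2 q.1.1)^[q.2.1] q.1.2 :=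
    measurable_from_prod_countable_left fun k => H.measurable_iterate_innerStep t k.2 k.1
  have hz : Measurable fun q : E d × Ξ × Fin m => gradStep Q p t q.2.1 q.1 :=
    (H.measurable_gradStep t).comp (measurable_fst.prodMk measurable_snd.fst)
  have hτ : Measurable fun q : E d × Ξ × Fin m => p.τ xt t (gradStep Q p t q.2.1 q.1) :=
    (measurable_τ p xt t).comp hz
  unfold outerStep
  exact Measurable.comp (g := fun q : (E d × E d) × ℕ × Fin m =>
      (innerStep Q p xt t q.2.2 q.1.1)^[q.2.1] q.1.2)
    (f := fun q : E d × Ξ × Fin m => ((gradStep Q p t q.2.1 q.1, q.1),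
      (p.τ xt t (gradStep Q p t q.2.1 q.1), q.2.2)))
    h1 ((hz.prodMk measurable_fst).prodMk (hτ.prodMk measurable_snd.snd))

end Measurability

theorem rate_mul_η_le (H : Assumptions Q P p r B σ G Bt xs xt) (t : ℕ) :
    p.rate * p.η t ≤ 1 / 4 := by
  have h1 := H.η_mul_le t
  have h2 := mul_pos (H.η_pos t) H.Lf_pos
  have h3 := mul_le_mul_of_nonneg_right H.rate_le (H.η_pos t).le
  linarith

theorem noiseLevel_nonneg (H : Assumptions Q P p r B σ G Bt xs xt) :
    0 ≤ noiseLevel r B σ G Bt p.ν p.Lg := by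
  have h1 : 0 ≤ B := (sq_nonneg _).trans H.norm_gradient_mean_sq_le
  have h2 := H.r_pos
  rw [noiseLevel]
  positivity

variable [IsProbabilityMeasure P]

/-- One-step bound in expectation over the sample, for any coupling of the two draws. -/
theorem lintegral_outerStep_le (H : Assumptions Q P p r B σ G Bt xs xt) {π : Measure (Ξ × Fin m)}
    [IsProbabilityMeasure π] (hfst : π.map Prod.fst = P)
    (hsnd : ∀ k, π (Prod.snd ⁻¹' {k}) = (m : ENNReal)⁻¹) (t : ℕ) (x : E d) :
    ∫⁻ q, ENNReal.ofReal (‖outerStep Q p xt t q.1 q.2 x - xs‖ ^ 2) ∂π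
      ≤ ENNReal.ofReal ((1 - p.rate * p.η t) * ‖x - xs‖ ^ 2
        + noiseLevel r B σ G Bt p.ν p.Lg * p.η t ^ 2) := by
  have hm : (0 : ℝ) < m := by exact_mod_cast H.m_pos
  have hmp : MeasurePreserving Prod.fst π P := ⟨measurable_fst, hfst⟩
  -- The deterministic bound is a function of ξ plus a function of j, so only the marginal laws
  -- matter.
  let U₁ : Ξ → ℝ := fun ξ => (1 + p.rate * p.η t / 16) * ‖x - xs‖ ^ 2
        - 35 / 32 * p.η t * inner ℝ (gradient (Q.f ξ) x - gradient (Q.f ξ) xs) (x - xs)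
        - 2 * p.η t * inner ℝ (gradient (Q.f ξ) xs - gradient (Q.mean P) xs) (x - xs)
        + 14 * p.η t ^ 2 * ‖gradient (Q.f ξ) xs - gradient (Q.mean P) xs‖ ^ 2
  let U₂ : Fin m → ℝ := fun j =>
        2 * p.η t * penaltySlope r G Bt p.ν p.Lg * Metric.infDist x Q.feasibleSet
        - 7 / 64 * Metric.infDist x (Q.constraintSet j) ^ 2
        + p.η t ^ 2 * (12 * penaltySlope r G Bt p.ν p.Lg ^ 2 + 16 * B)
  have hdiff : ∀ ξ, (inner ℝ (gradient (Q.f ξ) x - gradient (Q.f ξ) xs) (x - xs) : ℝ)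
      = inner ℝ (gradient (Q.f ξ) x) (x - xs) - inner ℝ (gradient (Q.f ξ) xs) (x - xs) :=
    fun ξ => inner_sub_left _ _ _
  have hInt := integrable_inner_gradient H.stoch H.smooth
  have hA : Integrable (fun ξ => (inner ℝ (gradient (Q.f ξ) x - gradient (Q.f ξ) xs) (x - xs) : ℝ))
      P := by
    simp only [hdiff]
    exact (hInt x _).sub (hInt xs _)
  have hA' : ∫ ξ, (inner ℝ (gradient (Q.f ξ) x - gradient (Q.f ξ) xs) (x - xs) : ℝ) ∂P
      = inner ℝ (gradient (Q.mean P) x - gradient (Q.mean P) xs) (x - xs) := by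
    simp only [hdiff]
    rw [integral_sub (hInt x _) (hInt xs _), integral_inner_gradient H.stoch H.smooth,
      integral_inner_gradient H.stoch H.smooth, inner_sub_left]
  have hB : Integrable
      (fun ξ => (inner ℝ (gradient (Q.f ξ) xs - gradient (Q.mean P) xs) (x - xs) : ℝ)) P := by
    simp only [inner_sub_left]
    exact (hInt xs _).sub (integrable_const _)
  have hB' : ∫ ξ, (inner ℝ (gradient (Q.f ξ) xs - gradient (Q.mean P) xs) (x - xs) : ℝ) ∂P = 0 := by
    simp only [inner_sub_left]
    rw [integral_sub (hInt xs _) (integrable_const _), integral_inner_gradient H.stoch H.smooth]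
    simp
  obtain ⟨hV, hV'⟩ := H.variance
  have i1 : Integrable U₁ P :=
    (((integrable_const _).sub (hA.const_mul _)).sub (hB.const_mul _)).add (hV.const_mul _)
  have i1' : ∫ ξ, U₁ ξ ∂P = (1 + p.rate * p.η t / 16) * ‖x - xs‖ ^ 2
        - 35 / 32 * p.η t * inner ℝ (gradient (Q.mean P) x - gradient (Q.mean P) xs) (x - xs)
        + 14 * p.η t ^ 2 * ∫ ξ, ‖gradient (Q.f ξ) xs - gradient (Q.mean P) xs‖ ^ 2 ∂P := by
    have e1 := integral_add
      (((integrable_const (μ := P) ((1 + p.rate * p.η t / 16) * ‖x - xs‖ ^ 2)).sub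
        (hA.const_mul (35 / 32 * p.η t))).sub (hB.const_mul (2 * p.η t)))
      (hV.const_mul (14 * p.η t ^ 2))
    have e2 := integral_sub
      ((integrable_const (μ := P) ((1 + p.rate * p.η t / 16) * ‖x - xs‖ ^ 2)).sub
        (hA.const_mul (35 / 32 * p.η t))) (hB.const_mul (2 * p.η t))
    have e3 := integral_sub (integrable_const (μ := P) ((1 + p.rate * p.η t / 16) * ‖x - xs‖ ^ 2))
        (hA.const_mul (35 / 32 * p.η t))
    simp only [Pi.sub_apply] at e1 e2
    rw [e2, e3] at e1
    simp only [integral_const_mul, hA', hB', integral_const, probReal_univ, one_smul, mul_zero,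
      sub_zero] at e1
    exact e1
  have : IsProbabilityMeasure (π.map Prod.snd) :=
    Measure.isProbabilityMeasure_map measurable_snd.aemeasurable
  have hmp' : MeasurePreserving Prod.snd π (π.map Prod.snd) := ⟨measurable_snd, rfl⟩
  have i2 : Integrable (fun q : Ξ × Fin m => U₂ q.2) π :=
    hmp'.integrable_comp_of_integrable (g := U₂) Integrable.of_finite
  have i2' : ∫ q, U₂ q.2 ∂π
      = 2 * p.η t * penaltySlope r G Bt p.ν p.Lg * Metric.infDist x Q.feasibleSet
        - 7 / 64 * ((∑ j, Metric.infDist x (Q.constraintSet j) ^ 2) / m)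
        + p.η t ^ 2 * (12 * penaltySlope r G Bt p.ν p.Lg ^ 2 + 16 * B) := by
    have h1 : ∫ q, U₂ q.2 ∂π = ∫ j, U₂ j ∂(π.map Prod.snd) :=
      (integral_map measurable_snd.aemeasurable (by fun_prop)).symm
    rw [h1, integral_fintype Integrable.of_finite]
    have h2 : ∀ k, (π.map Prod.snd).real {k} = (m : ℝ)⁻¹ := by
      intro k
      rw [Measure.real, Measure.map_apply measurable_snd (measurableSet_singleton k), hsnd]
      simp
    simp only [h2, smul_eq_mul, U₂]
    have h3 : ∑ j, 7 / 64 * Metric.infDist x (Q.constraintSet j) ^ 2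
        = 7 / 64 * ∑ j, Metric.infDist x (Q.constraintSet j) ^ 2 := (Finset.mul_sum _ _ _).symm
    rw [← Finset.mul_sum, Finset.sum_add_distrib, Finset.sum_sub_distrib, h3]
    simp only [Finset.sum_const, Finset.card_univ, Fintype.card_fin, nsmul_eq_mul]
    generalize ∑ j, Metric.infDist x (Q.constraintSet j) ^ 2 = S
    field_simp
  have i1π : Integrable (fun q : Ξ × Fin m => U₁ q.1) π := hmp.integrable_comp_of_integrable i1
  have i1π' : ∫ q, U₁ q.1 ∂π = ∫ ξ, U₁ ξ ∂P := by
    rw [← hfst, integral_map measurable_fst.aemeasurable (by rw [hfst]; exact i1.1)]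
  have hU : ∀ q : Ξ × Fin m, ‖outerStep Q p xt t q.1 q.2 x - xs‖ ^ 2 ≤ U₁ q.1 + U₂ q.2 :=
    fun q => H.outerStep_le t q.1 q.2 x
  have hU0 : ∀ q : Ξ × Fin m, 0 ≤ U₁ q.1 + U₂ q.2 := fun q => (sq_nonneg _).trans (hU q)
  calc _ ≤ ∫⁻ q, ENNReal.ofReal (U₁ q.1 + U₂ q.2) ∂π :=
        lintegral_mono fun q => ENNReal.ofReal_le_ofReal (hU q)
    _ = ENNReal.ofReal (∫ q, (U₁ q.1 + U₂ q.2) ∂π) :=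
        (ofReal_integral_eq_lintegral_ofReal (i1π.add i2) (Filter.Eventually.of_forall hU0)).symm
    _ ≤ _ := by
        refine ENNReal.ofReal_le_ofReal ?_
        rw [integral_add i1π i2, i1π', i1', i2']
        have hη := H.η_pos t
        have hr := H.r_pos
        have s1 := mul_norm_sq_le_inner_gradient_sub H.strong H.μ_pos.le
          (differentiable_mean H.stoch H.smooth) x xs
        have s2 := H.regular x
        have s3 : 14 * p.η t ^ 2 * ∫ ξ, ‖gradient (Q.f ξ) xs - gradient (Q.mean P) xs‖ ^ 2 ∂P
            ≤ 14 * p.η t ^ 2 * σ ^ 2 := by gcongr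
        -- Since 35/32 - 1/16 ≥ 1, this outweighs the growth factor 1 + aη/16 and leaves 1 - aη.
        have s4 : 35 / 32 * p.η t * (p.rate * ‖x - xs‖ ^ 2) ≤ 35 / 32 * p.η t *
            inner ℝ (gradient (Q.mean P) x - gradient (Q.mean P) xs) (x - xs) := by
          gcongr
          refine le_trans ?_ s1
          gcongr
          exact H.rate_le
        have s5 : 0 ≤ p.η t * (p.rate * ‖x - xs‖ ^ 2) := by have := H.rate_pos; positivity
        rw [noiseLevel]
        set K := penaltySlope r G Bt p.ν p.Lg
        set D := Metric.infDist x Q.feasibleSet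
        -- Completing the square: the quadratic gain from linear regularity absorbs the linear
        -- exact-penalty loss.
        have s6 : 2 * p.η t * K * D - 7 / 64 * (r * D ^ 2) ≤ 10 * K ^ 2 / r * p.η t ^ 2 := by
          have e : 10 * K ^ 2 / r * p.η t ^ 2 - (2 * p.η t * K * D - 7 / 64 * (r * D ^ 2))
              = (10 * (K * p.η t - r * D / 10) ^ 2 + 3 / 320 * (r * D) ^ 2) / r := by
            field_simp
            ring
          have : 0 ≤ (10 * (K * p.η t - r * D / 10) ^ 2 + 3 / 320 * (r * D) ^ 2) / r := by positivity
          linarith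
        linarith

end Assumptions

/-! ### Independence of past and present draws, and the recursion for the mean squared error. -/

namespace Assumptions

variable {d m : ℕ} {Ξ : Type*} [MeasurableSpace Ξ] {Q : Problem d m Ξ} {P : Measure Ξ}
  {p : Params} {r B σ G Bt : ℝ} {xs xt : E d}
  {Ω : Type*} {i : ℕ → Ω → Ξ} {j : ℕ → Ω → Fin m}

/-- The iterate `x_t` is determined by the samples drawn before time `t`. -/
theorem measurable_iter_iSup (H : Assumptions Q P p r B σ G Bt xs xt) (x₁ : E d) (t : ℕ) :
    Measurable[⨆ s ∈ {s : ℕ | s < t}, MeasurableSpace.comap (fun ω => (i s ω, j s ω)) inferInstance]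
      fun ω => iter Q p xt x₁ (fun s => i s ω) (fun s => j s ω) t := by
  induction t with
  | zero => exact measurable_const
  | succ t ih =>
    cases t with
    | zero => exact measurable_const
    | succ t =>
      set 𝓕 : MeasurableSpace Ω := ⨆ s ∈ {s : ℕ | s < t + 1 + 1},
        MeasurableSpace.comap (fun ω => (i s ω, j s ω)) inferInstance
      have h1 : Measurable[𝓕] fun ω => iter Q p xt x₁ (fun s => i s ω) (fun s => j s ω) (t + 1) :=
        ih.mono (biSup_mono fun s (hs : s < t + 1) => hs.trans (Nat.lt_succ_self _)) le_rfl
      have h2 : Measurable[𝓕] fun ω => (i (t + 1) ω, j (t + 1) ω) :=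
        (comap_measurable _).mono (le_biSup (fun s => MeasurableSpace.comap
          (fun ω => (i s ω, j s ω)) inferInstance) (Nat.lt_succ_self (t + 1))) le_rfl
      simp only [iter]
      exact Measurable.comp
        (g := fun q : E d × Ξ × Fin m => outerStep Q p xt (t + 1) q.2.1 q.2.2 q.1)
        (f := fun ω => (iter Q p xt x₁ (fun s => i s ω) (fun s => j s ω) (t + 1),
          (i (t + 1) ω, j (t + 1) ω)))
        (H.measurable_outerStep (t + 1)) (h1.prodMk h2)

variable [MeasurableSpace Ω] {Pr : Measure Ω}

theorem measurable_iter (H : Assumptions Q P p r B σ G Bt xs xt) (hS : IsSampling P Pr i j)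
    (x₁ : E d) (t : ℕ) :
    Measurable fun ω => iter Q p xt x₁ (fun s => i s ω) (fun s => j s ω) t :=
  (H.measurable_iter_iSup x₁ t).mono
    (iSup₂_le fun s _ => ((hS.measurable_i s).prodMk (hS.measurable_j s)).comap_le) le_rfl

/-- The iterate `x_t` is independent of the samples drawn at time `t`. -/
theorem indepFun_iter (H : Assumptions Q P p r B σ G Bt xs xt) (hS : IsSampling P Pr i j)
    (x₁ : E d) (t : ℕ) :
    IndepFun (fun ω => iter Q p xt x₁ (fun s => i s ω) (fun s => j s ω) t)
      (fun ω => (i t ω, j t ω)) Pr := by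
  have h1 := indep_iSup_of_disjoint
    (fun s => ((hS.measurable_i s).prodMk (hS.measurable_j s)).comap_le) hS.indep
    (S := {s | s < t}) (T := {t}) (by simp)
  rw [IndepFun_iff_Indep]
  refine indep_of_indep_of_le_left (indep_of_indep_of_le_right h1 ?_)
    (H.measurable_iter_iSup x₁ t).comap_le
  exact le_biSup (fun s => MeasurableSpace.comap
          (fun ω => (i s ω, j s ω)) inferInstance) (Set.mem_singleton t)

variable [IsProbabilityMeasure P] [IsProbabilityMeasure Pr]

/-- One step of the outer recursion for the mean squared error. -/
theorem integral_step (H : Assumptions Q P p r B σ G Bt xs xt) (hS : IsSampling P Pr i j)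
    (x₁ : E d) {t : ℕ} (ht : 1 ≤ t)
    (hInt : Integrable (fun ω =>
      ‖iter Q p xt x₁ (fun s => i s ω) (fun s => j s ω) t - xs‖ ^ 2) Pr) :
    Integrable (fun ω =>
      ‖iter Q p xt x₁ (fun s => i s ω) (fun s => j s ω) (t + 1) - xs‖ ^ 2) Pr ∧
    ∫ ω, ‖iter Q p xt x₁ (fun s => i s ω) (fun s => j s ω) (t + 1) - xs‖ ^ 2 ∂Pr
      ≤ (1 - p.rate * p.η t) *
          ∫ ω, ‖iter Q p xt x₁ (fun s => i s ω) (fun s => j s ω) t - xs‖ ^ 2 ∂Pr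
        + noiseLevel r B σ G Bt p.ν p.Lg * p.η t ^ 2 := by
  set X : ℕ → Ω → E d := fun t ω => iter Q p xt x₁ (fun s => i s ω) (fun s => j s ω) t with hX
  have hXm : ∀ t, Measurable (X t) := H.measurable_iter hS x₁
  set Y : Ω → Ξ × Fin m := fun ω => (i t ω, j t ω) with hY
  have hYm : Measurable Y := (hS.measurable_i t).prodMk (hS.measurable_j t)
  have hsucc : ∀ ω, X (t + 1) ω = outerStep Q p xt t (Y ω).1 (Y ω).2 (X t ω) := by
    intro ω
    -- The value at index 0 is a filler, so the outer-step equation is available only from t = 1.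
    obtain ⟨t, rfl⟩ := Nat.exists_eq_add_of_le' ht
    rfl
  have hprod := (indepFun_iff_map_prod_eq_prod_map_map (hXm t).aemeasurable hYm.aemeasurable).1
    (H.indepFun_iter hS x₁ t)
  have : IsProbabilityMeasure (Pr.map Y) := Measure.isProbabilityMeasure_map hYm.aemeasurable
  have : IsProbabilityMeasure (Pr.map (X t)) :=
    Measure.isProbabilityMeasure_map (hXm t).aemeasurable
  have hfst : (Pr.map Y).map Prod.fst = P := by
    rw [Measure.map_map measurable_fst hYm]
    exact hS.law_i t
  have hsnd : ∀ k, (Pr.map Y) (Prod.snd ⁻¹' {k}) = (m : ENNReal)⁻¹ := by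
    intro k
    rw [Measure.map_apply hYm (measurable_snd (measurableSet_singleton k))]
    exact hS.law_j t k
  have hΦ : Measurable fun q : E d × Ξ × Fin m =>
      ENNReal.ofReal (‖outerStep Q p xt t q.2.1 q.2.2 q.1 - xs‖ ^ 2) :=
    (((H.measurable_outerStep t).sub_const xs).norm.pow_const 2).ennreal_ofReal
  have hC := H.noiseLevel_nonneg
  have hrate := H.rate_mul_η_le t
  set C := noiseLevel r B σ G Bt p.ν p.Lg
  have hbm : Measurable fun x : E d => ENNReal.ofReal ((1 - p.rate * p.η t) * ‖x - xs‖ ^ 2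
      + C * p.η t ^ 2) := by fun_prop
  have hbint : Integrable (fun ω => (1 - p.rate * p.η t) * ‖X t ω - xs‖ ^ 2 + C * p.η t ^ 2) Pr :=
    (hInt.const_mul _).add (integrable_const _)
  have hb0 : ∀ ω, 0 ≤ (1 - p.rate * p.η t) * ‖X t ω - xs‖ ^ 2 + C * p.η t ^ 2 := by
    intro ω
    have : 0 ≤ 1 - p.rate * p.η t := by linarith
    positivity
  -- Using the lower integral, finiteness of the bound also proves integrability of the next error,
  -- which is not known beforehand.
  have hlin : ∫⁻ ω, ENNReal.ofReal (‖X (t + 1) ω - xs‖ ^ 2) ∂Pr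
      ≤ ENNReal.ofReal ((1 - p.rate * p.η t) * ∫ ω, ‖X t ω - xs‖ ^ 2 ∂Pr + C * p.η t ^ 2) := by
    calc ∫⁻ ω, ENNReal.ofReal (‖X (t + 1) ω - xs‖ ^ 2) ∂Pr
        = ∫⁻ q, ENNReal.ofReal (‖outerStep Q p xt t q.2.1 q.2.2 q.1 - xs‖ ^ 2)
            ∂(Pr.map fun ω => (X t ω, Y ω)) := by
          rw [lintegral_map hΦ ((hXm t).prodMk hYm)]
          exact lintegral_congr fun ω => by rw [hsucc]
      _ = ∫⁻ x, ∫⁻ y, ENNReal.ofReal (‖outerStep Q p xt t y.1 y.2 x - xs‖ ^ 2)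
            ∂(Pr.map Y) ∂(Pr.map (X t)) := by
          rw [hprod, lintegral_prod _ hΦ.aemeasurable]
      _ ≤ ∫⁻ x, ENNReal.ofReal ((1 - p.rate * p.η t) * ‖x - xs‖ ^ 2 + C * p.η t ^ 2)
            ∂(Pr.map (X t)) :=
          lintegral_mono fun x => H.lintegral_outerStep_le hfst hsnd t x
      _ = ∫⁻ ω, ENNReal.ofReal ((1 - p.rate * p.η t) * ‖X t ω - xs‖ ^ 2 + C * p.η t ^ 2) ∂Pr :=
          lintegral_map hbm (hXm t)
      _ = ENNReal.ofReal (∫ ω, ((1 - p.rate * p.η t) * ‖X t ω - xs‖ ^ 2 + C * p.η t ^ 2) ∂Pr) :=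
          (ofReal_integral_eq_lintegral_ofReal hbint (Filter.Eventually.of_forall hb0)).symm
      _ = _ := by
          rw [integral_add (hInt.const_mul _) (integrable_const _), integral_const_mul,
            integral_const, probReal_univ, one_smul]
  have hmeas : AEStronglyMeasurable (fun ω => ‖X (t + 1) ω - xs‖ ^ 2) Pr :=
    (((hXm (t + 1)).sub_const xs).norm.pow_const 2).aestronglyMeasurable
  have hnn : 0 ≤ᵐ[Pr] fun ω => ‖X (t + 1) ω - xs‖ ^ 2 :=
    Filter.Eventually.of_forall fun ω => sq_nonneg _
  refine ⟨⟨hmeas, ?_⟩, ?_⟩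
  · rw [hasFiniteIntegral_iff_ofReal hnn]
    exact hlin.trans_lt ENNReal.ofReal_lt_top
  · rw [integral_eq_lintegral_of_nonneg_ae hnn hmeas]
    refine ENNReal.toReal_le_of_le_ofReal ?_ hlin
    have h1 : 0 ≤ ∫ ω, ‖X t ω - xs‖ ^ 2 ∂Pr := integral_nonneg fun ω => sq_nonneg _
    have h2 : 0 ≤ 1 - p.rate * p.η t := by linarith
    positivity

end Assumptions

/-! ### Convergence rate, expected inner length and expected number of oracle calls. -/

/-- Bound on the mean squared distance between gradient steps and the Slater point. -/
noncomputable def slaterDistBound (r B σ G Bt ν Lg Bx μ : ℝ) : ℝ :=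
  5 * (Bx ^ 2 + |noiseLevel r B σ G Bt ν Lg| / (4 * μ ^ 2)) + (σ ^ 2 + |B|) / (8 * μ ^ 2)
    + 6 * |Bt| / μ

/-- The constant in the bound on the expected length of the inner loop. -/
noncomputable def innerLengthConst (r B σ G Bt ν Lg Bx μ : ℝ) : ℝ :=
  1 + 7 / 4 * (1 + Lg / (2 * ν) * slaterDistBound r B σ G Bt ν Lg Bx μ)

/-- A recursion with step sizes `2 / (a (t + t₀))` forgets its start quadratically. -/
theorem recursion_bound {D : ℕ → ℝ} {a C t₀ : ℝ} (ha : 0 < a) (hC : 0 ≤ C) (ht₀ : 2 ≤ t₀)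
    (hD : ∀ t, 0 ≤ D t)
    (hrec : ∀ t : ℕ, 1 ≤ t → D (t + 1) ≤ (1 - 2 / (t + t₀)) * D t + C * (2 / (a * (t + t₀))) ^ 2)
    {T : ℕ} (hT : 1 ≤ T) :
    D T ≤ t₀ ^ 2 * D 1 / (T : ℝ) ^ 2 + 4 * C / (a ^ 2 * T) := by
  -- With S = t + t₀, the weights telescope because S(S - 1)(1 - 2/S) = (S - 1)(S - 2), and each
  -- weighted noise term is at most 4C/a².
  have key : ∀ T : ℕ, 1 ≤ T →
      (T + t₀ - 1) * (T + t₀ - 2) * D T ≤ t₀ ^ 2 * D 1 + 4 * C / a ^ 2 * T := by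
    intro T hT
    induction T, hT using Nat.le_induction with
    | base =>
      have h1 := hD 1
      have h2 : 0 ≤ 4 * C / a ^ 2 := by positivity
      have h3 : 0 ≤ t₀ * D 1 := by positivity
      push_cast
      nlinarith
    | succ t ht ih =>
      have ht' : (1 : ℝ) ≤ t := by exact_mod_cast ht
      set S : ℝ := t + t₀ with hS
      have hS0 : 3 ≤ S := by linarith
      have h1 : S * (S - 1) * D (t + 1)
          ≤ S * (S - 1) * ((1 - 2 / S) * D t + C * (2 / (a * S)) ^ 2) := by
        refine mul_le_mul_of_nonneg_left (hrec t ht) ?_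
        nlinarith
      have h2 : S * (S - 1) * ((1 - 2 / S) * D t + C * (2 / (a * S)) ^ 2)
          = (S - 1) * (S - 2) * D t + 4 * C / a ^ 2 * ((S - 1) / S) := by
        have : S ≠ 0 := by linarith
        field_simp
        ring
      have h3 : 4 * C / a ^ 2 * ((S - 1) / S) ≤ 4 * C / a ^ 2 * 1 := by
        gcongr
        rw [div_le_one (by linarith)]
        linarith
      have e : ((t + 1 : ℕ) : ℝ) + t₀ = S + 1 := by push_cast; rw [hS]; ring
      rw [e]
      push_cast
      have e2 : (S + 1 - 1) * (S + 1 - 2) = S * (S - 1) := by ring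
      rw [e2]
      linarith
  have hT' : (1 : ℝ) ≤ T := by exact_mod_cast hT
  have h1 := key T hT
  -- Here t₀ ≥ 2 is used: the weight is at least (T + 1)T.
  have h2 : (T : ℝ) ^ 2 * D T ≤ (T + t₀ - 1) * (T + t₀ - 2) * D T := by
    have h3 := hD T
    gcongr
    nlinarith
  have h3 : D T ≤ (t₀ ^ 2 * D 1 + 4 * C / a ^ 2 * T) / (T : ℝ) ^ 2 := by
    rw [le_div_iff₀ (by positivity)]
    linarith
  refine h3.trans (le_of_eq ?_)
  field_simp

/-- Since t + 32 ≤ 2⁵(t + 1), the excess is 5 log 2, and (1 + κ)(t + 1) ≥ 2² makes this at most 5/2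
of the logarithm on the right. -/
theorem log_add_le {t : ℕ} (ht : 1 ≤ t) {κ : ℝ} (hκ : 1 ≤ κ) :
    Real.log ((t + 32) * (1 + κ)) ≤ 7 / 2 * Real.log ((1 + κ) * (t + 1)) := by
  have ht' : (1 : ℝ) ≤ t := by exact_mod_cast ht
  have h4 : (4 : ℝ) ≤ (1 + κ) * (t + 1) := by nlinarith
  have h1 : Real.log ((t + 32) * (1 + κ)) ≤ Real.log (2 ^ 5 * ((1 + κ) * (t + 1))) := by
    refine Real.log_le_log (by positivity) ?_
    nlinarith
  rw [Real.log_mul (x := 2 ^ 5) (by norm_num) (by positivity), Real.log_pow] at h1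
  have h2 : Real.log ((2 : ℝ) ^ 2) ≤ Real.log ((1 + κ) * (t + 1)) :=
    Real.log_le_log (by norm_num) (by linarith)
  rw [Real.log_pow] at h2
  push_cast at h1 h2
  linarith

theorem one_le_log_mul {t : ℕ} (ht : 1 ≤ t) {κ : ℝ} (hκ : 1 ≤ κ) :
    1 ≤ Real.log ((1 + κ) * (t + 1)) := by
  have ht' : (1 : ℝ) ≤ t := by exact_mod_cast ht
  have h2 : Real.log ((2 : ℝ) ^ 2) ≤ Real.log ((1 + κ) * (t + 1)) :=
    Real.log_le_log (by norm_num) (by nlinarith)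
  rw [Real.log_pow] at h2
  push_cast at h2
  linarith [Real.log_two_gt_d9]

theorem integral_error_one {d m : ℕ} {Ξ Ω : Type*} [MeasurableSpace Ω] {Pr : Measure Ω}
    [IsProbabilityMeasure Pr] (Q : Problem d m Ξ) (p : Params) (xs xt x₁ : E d) (i : ℕ → Ω → Ξ)
    (j : ℕ → Ω → Fin m) :
    ∫ ω, ‖iter Q p xt x₁ (fun s => i s ω) (fun s => j s ω) 1 - xs‖ ^ 2 ∂Pr = ‖x₁ - xs‖ ^ 2 := by
  simp [iter]

namespace Assumptions

variable {d m : ℕ} {Ξ : Type*} [MeasurableSpace Ξ] {Q : Problem d m Ξ} {P : Measure Ξ}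
  {p : Params} {r B σ G Bt Bx : ℝ} {xs xt : E d}
  {Ω : Type*} [MeasurableSpace Ω] {Pr : Measure Ω} {i : ℕ → Ω → Ξ} {j : ℕ → Ω → Fin m}

theorem half_μ_le_rate (H : Assumptions Q P p r B σ G Bt xs xt) : p.μ / 2 ≤ p.rate := by
  have h1 := H.μ_pos
  have h2 := H.μ_le
  rw [Params.rate, le_div_iff₀ (by linarith)]
  nlinarith

theorem η_le (H : Assumptions Q P p r B σ G Bt xs xt) (t : ℕ) : p.η t ≤ 1 / (8 * p.μ) := by
  have h1 := H.μ_pos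
  have h2 := H.η_mul_le t
  have h3 := mul_le_mul_of_nonneg_left H.μ_le (H.η_pos t).le
  rw [le_div_iff₀ (by positivity)]
  linarith

/-- The form required by `recursion_bound`; the offset t₀ is of the order of κ, which is where κ² in
the rate comes from. -/
theorem η_eq (H : Assumptions Q P p r B σ G Bt xs xt) (t : ℕ) :
    p.η t = 2 / (p.rate * (t + 8 * (p.μ + p.Lf) ^ 2 / (p.μ * p.Lf))) := by
  have h1 := H.μ_pos
  have h2 := H.Lf_pos
  rw [Params.η, Params.rate]
  field_simp

/-- The squared distance of a gradient step to the Slater point. -/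
theorem norm_gradStep_sub_sq_le (H : Assumptions Q P p r B σ G Bt xs xt) (t : ℕ) (ξ : Ξ)
    (x : E d) (hxt : ‖xt - xs‖ ^ 2 ≤ 2 * Bt / p.μ) :
    ‖gradStep Q p t ξ x - xt‖ ^ 2 ≤ 5 * ‖x - xs‖ ^ 2
      + (‖gradient (Q.f ξ) xs - gradient (Q.mean P) xs‖ ^ 2 + |B|) / (8 * p.μ ^ 2)
      + 6 * |Bt| / p.μ := by
  have hη := H.η_pos t
  have hμ := H.μ_pos
  have hB := H.norm_gradient_mean_sq_le
  set n := gradient (Q.f ξ) x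
  set s := gradient (Q.f ξ) xs
  set gF := gradient (Q.mean P) xs
  -- Three contributions: one controlled by the Lipschitz bound and ηL_f ≤ 1/4, the gradient at the
  -- solution, and the Slater distance. Squaring costs a factor 3, and 3 · (5/4)² ≤ 5.
  have e : gradStep Q p t ξ x - xt = ((x - xs) - p.η t • (n - s)) + (-(p.η t • s) - (xt - xs)) := by
    rw [gradStep, smul_sub]; abel
  have h1 : ‖(x - xs) - p.η t • (n - s)‖ ≤ 5 / 4 * ‖x - xs‖ := by
    refine (norm_sub_le _ _).trans ?_
    rw [norm_smul, Real.norm_of_nonneg hη.le]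
    have h2 : p.η t * ‖n - s‖ ≤ p.η t * (p.Lf * ‖x - xs‖) := by
      gcongr
      exact (H.smooth.f_smooth ξ).2 x xs
    have h3 : p.η t * p.Lf * ‖x - xs‖ ≤ 1 / 4 * ‖x - xs‖ := by
      gcongr
      exact H.η_mul_Lf_le t
    linarith
  have h2 : ‖-(p.η t • s) - (xt - xs)‖ ≤ p.η t * ‖s‖ + ‖xt - xs‖ := by
    refine (norm_sub_le _ _).trans ?_
    rw [norm_neg, norm_smul, Real.norm_of_nonneg hη.le]
  have h3 : ‖gradStep Q p t ξ x - xt‖ ≤ 5 / 4 * ‖x - xs‖ + (p.η t * ‖s‖ + ‖xt - xs‖) := by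
    rw [e]
    exact (norm_add_le _ _).trans (add_le_add h1 h2)
  have h4 : ‖gradStep Q p t ξ x - xt‖ ^ 2
      ≤ (5 / 4 * ‖x - xs‖ + (p.η t * ‖s‖ + ‖xt - xs‖)) ^ 2 := by gcongr
  have h5 : ‖s‖ ^ 2 ≤ 2 * (‖s - gF‖ ^ 2 + |B|) := by
    have h6 : ‖s‖ ≤ ‖gF‖ + ‖s - gF‖ := norm_le_norm_add_norm_sub' _ _
    have h7 : ‖s‖ ^ 2 ≤ (‖gF‖ + ‖s - gF‖) ^ 2 := by gcongr
    linarith [sq_nonneg (‖gF‖ - ‖s - gF‖), le_abs_self B]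
  have h6 : 3 * (p.η t * ‖s‖) ^ 2 ≤ (‖s - gF‖ ^ 2 + |B|) / (8 * p.μ ^ 2) := by
    calc 3 * (p.η t * ‖s‖) ^ 2 = 3 * (p.η t ^ 2 * ‖s‖ ^ 2) := by ring
      _ ≤ 3 * ((1 / (8 * p.μ)) ^ 2 * (2 * (‖s - gF‖ ^ 2 + |B|))) := by
        gcongr
        exact H.η_le t
      _ = 3 / 4 * ((‖s - gF‖ ^ 2 + |B|) / (8 * p.μ ^ 2)) := by field_simp; ring
      _ ≤ _ := by
        have : 0 ≤ (‖s - gF‖ ^ 2 + |B|) / (8 * p.μ ^ 2) := by positivity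
        linarith
  have h7 : 2 * Bt / p.μ ≤ 2 * |Bt| / p.μ := by gcongr; exact le_abs_self _
  have h8 : 6 * |Bt| / p.μ = 3 * (2 * |Bt| / p.μ) := by ring
  linarith [sq_nonneg (5 / 4 * ‖x - xs‖ - p.η t * ‖s‖), sq_nonneg (5 / 4 * ‖x - xs‖ - ‖xt - xs‖),
    sq_nonneg (p.η t * ‖s‖ - ‖xt - xs‖), sq_nonneg ‖x - xs‖]

variable [IsProbabilityMeasure P] [IsProbabilityMeasure Pr]

theorem integrable_error (H : Assumptions Q P p r B σ G Bt xs xt) (hS : IsSampling P Pr i j)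
    (x₁ : E d) {t : ℕ} (ht : 1 ≤ t) : Integrable (fun ω =>
      ‖iter Q p xt x₁ (fun s => i s ω) (fun s => j s ω) t - xs‖ ^ 2) Pr := by
  induction t, ht using Nat.le_induction with
  | base => exact integrable_const (μ := Pr) (‖x₁ - xs‖ ^ 2)
  | succ t ht ih => exact (H.integral_step hS x₁ ht ih).1

/-- The convergence rate. -/
theorem integral_error_le (H : Assumptions Q P p r B σ G Bt xs xt) (hS : IsSampling P Pr i j)
    {x₁ : E d} (hx₁ : ‖x₁ - xs‖ ≤ Bx) {T : ℕ} (hT : 1 ≤ T) :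
    ∫ ω, ‖iter Q p xt x₁ (fun s => i s ω) (fun s => j s ω) T - xs‖ ^ 2 ∂Pr
      ≤ (1024 * Bx ^ 2 + 16 * |noiseLevel r B σ G Bt p.ν p.Lg| + 1) *
        (1 / (p.μ ^ 2 * T) + p.κ ^ 2 / (T : ℝ) ^ 2) := by
  have hμ := H.μ_pos
  have hL := H.Lf_pos
  have hμL := H.μ_le
  have hT' : (1 : ℝ) ≤ T := by exact_mod_cast hT
  have hC := H.noiseLevel_nonneg
  rw [abs_of_nonneg hC]
  set C := noiseLevel r B σ G Bt p.ν p.Lg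
  set t₀ := 8 * (p.μ + p.Lf) ^ 2 / (p.μ * p.Lf) with ht₀
  have ht₀2 : 2 ≤ t₀ := by
    rw [ht₀, le_div_iff₀ (by positivity)]
    nlinarith
  have ht₀κ : t₀ ≤ 32 * p.κ := by
    rw [ht₀, Params.κ, div_le_iff₀ (by positivity)]
    have : 32 * (p.Lf / p.μ) * (p.μ * p.Lf) = 32 * p.Lf ^ 2 := by field_simp
    rw [this]
    nlinarith
  have ha := H.rate_pos
  have hrec := recursion_bound (D := fun t => ∫ ω, ‖iter Q p xt x₁ (fun s => i s ω)
      (fun s => j s ω) t - xs‖ ^ 2 ∂Pr) ha hC ht₀2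
    (fun t => integral_nonneg fun ω => sq_nonneg _)
    (fun t ht => by
      have h1 := (H.integral_step hS x₁ ht (H.integrable_error hS x₁ ht)).2
      have h2 := H.η_eq t
      rw [← ht₀] at h2
      have h3 : p.rate * p.η t = 2 / (t + t₀) := by
        have : 0 < (t : ℝ) + t₀ := by positivity
        rw [h2]
        field_simp
      rwa [h3, h2] at h1) hT
  rw [integral_error_one] at hrec
  refine hrec.trans ?_
  have h1 : t₀ ^ 2 * ‖x₁ - xs‖ ^ 2 / (T : ℝ) ^ 2 ≤ 1024 * Bx ^ 2 * (p.κ ^ 2 / (T : ℝ) ^ 2) := by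
    calc t₀ ^ 2 * ‖x₁ - xs‖ ^ 2 / (T : ℝ) ^ 2 ≤ (32 * p.κ) ^ 2 * Bx ^ 2 / (T : ℝ) ^ 2 := by gcongr
      _ = _ := by ring
  have h2 : 4 * C / (p.rate ^ 2 * T) ≤ 16 * C * (1 / (p.μ ^ 2 * T)) := by
    calc 4 * C / (p.rate ^ 2 * T) ≤ 4 * C / ((p.μ / 2) ^ 2 * T) := by
          gcongr
          exact H.half_μ_le_rate
      _ = _ := by field_simp; ring
  have h3 : 0 ≤ 1 / (p.μ ^ 2 * T) := by positivity
  have h4 : 0 ≤ p.κ ^ 2 / (T : ℝ) ^ 2 := by positivity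
  have h5 := mul_nonneg (sq_nonneg Bx) h3
  have h6 := mul_nonneg hC h4
  linarith

/-- A bound on the mean squared error that is uniform in `t` and `Lf`. -/
theorem integral_error_le_const (H : Assumptions Q P p r B σ G Bt xs xt)
    (hS : IsSampling P Pr i j) {x₁ : E d} (hx₁ : ‖x₁ - xs‖ ≤ Bx) {t : ℕ} (ht : 1 ≤ t) :
    ∫ ω, ‖iter Q p xt x₁ (fun s => i s ω) (fun s => j s ω) t - xs‖ ^ 2 ∂Pr
      ≤ Bx ^ 2 + |noiseLevel r B σ G Bt p.ν p.Lg| / (4 * p.μ ^ 2) := by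
  have hμ := H.μ_pos
  have hC := H.noiseLevel_nonneg
  rw [abs_of_nonneg hC]
  induction t, ht using Nat.le_induction with
  | base =>
    rw [integral_error_one]
    have h1 : ‖x₁ - xs‖ ^ 2 ≤ Bx ^ 2 := by gcongr
    have h2 : 0 ≤ noiseLevel r B σ G Bt p.ν p.Lg / (4 * p.μ ^ 2) := by positivity
    linarith
  | succ t ht ih =>
    refine (H.integral_step hS x₁ ht (H.integrable_error hS x₁ ht)).2.trans ?_
    set C := noiseLevel r B σ G Bt p.ν p.Lg
    have hη := H.η_pos t
    have hr1 := H.rate_mul_η_le t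
    have h1 := mul_le_mul_of_nonneg_left ih (by linarith : 0 ≤ 1 - p.rate * p.η t)
    -- The bound reproduces itself because η ≤ 1/(8μ) and the rate is at least μ/2. Unlike the
    -- convergence rate, it contains no κ.
    have h2 : C * p.η t ^ 2 ≤ p.rate * p.η t * (C / (4 * p.μ ^ 2)) := by
      have h3 : p.η t ≤ p.rate * (1 / (4 * p.μ ^ 2)) := by
        calc p.η t ≤ 1 / (8 * p.μ) := H.η_le t
          _ = p.μ / 2 * (1 / (4 * p.μ ^ 2)) := by field_simp; norm_num
          _ ≤ _ := by gcongr; exact H.half_μ_le_rate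
      calc C * p.η t ^ 2 = C * p.η t * p.η t := by ring
        _ ≤ C * p.η t * (p.rate * (1 / (4 * p.μ ^ 2))) := by gcongr
        _ = _ := by ring
    have h3 : 0 ≤ p.rate * p.η t * Bx ^ 2 := by have := H.rate_pos; positivity
    linarith

/-- The expected length of the inner loop. -/
theorem integral_innerLength_le (H : Assumptions Q P p r B σ G Bt xs xt)
    (hS : IsSampling P Pr i j) {x₁ : E d} (hx₁ : ‖x₁ - xs‖ ≤ Bx) {t : ℕ} (ht : 1 ≤ t) :
    Integrable (fun ω => (innerLength Q p xt x₁ (fun s => i s ω) (fun s => j s ω) t : ℝ)) Pr ∧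
    ∫ ω, (innerLength Q p xt x₁ (fun s => i s ω) (fun s => j s ω) t : ℝ) ∂Pr
      ≤ innerLengthConst r B σ G Bt p.ν p.Lg Bx p.μ * Real.log ((1 + p.κ) * (t + 1)) := by
  have hμ := H.μ_pos
  have hν := H.ν_pos
  have hLg := H.Lg_nonneg
  set X : Ω → E d := fun ω => iter Q p xt x₁ (fun s => i s ω) (fun s => j s ω) t with hX
  have hXm : Measurable X := H.measurable_iter hS x₁ t
  set V : Ξ → ℝ := fun ξ => ‖gradient (Q.f ξ) xs - gradient (Q.mean P) xs‖ ^ 2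
  have hmp : MeasurePreserving (i t) Pr P := ⟨hS.measurable_i t, hS.law_i t⟩
  have hVint : Integrable (fun ω => V (i t ω)) Pr :=
    hmp.integrable_comp_of_integrable H.variance.1
  have hV : ∫ ω, V (i t ω) ∂Pr ≤ σ ^ 2 := by
    have : ∫ ω, V (i t ω) ∂Pr = ∫ ξ, V ξ ∂P := by
      have h1 := integral_map (μ := Pr) (φ := i t) (f := V) (hS.measurable_i t).aemeasurable
        (by rw [hS.law_i t]; exact H.variance.1.1)
      rw [← h1, hS.law_i t]
    rw [this]
    exact H.variance.2
  have hDint := H.integrable_error hS x₁ ht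
  have hD := H.integral_error_le_const hS hx₁ ht
  set Λ := Real.log ((1 + p.κ) * (t + 1))
  have hΛ1 : 1 ≤ Λ := one_le_log_mul ht H.κ_ge
  have hΛ : Real.log ((t + 32) * (1 + p.κ)) ≤ 7 / 2 * Λ := log_add_le ht H.κ_ge
  have hlog0 : 0 ≤ Real.log ((t + 32) * (1 + p.κ)) := by
    refine Real.log_nonneg ?_
    have h1 := H.κ_ge
    have h2 : (0 : ℝ) ≤ t := t.cast_nonneg
    nlinarith
  set c := p.Lg / (2 * p.ν) with hc
  have hc0 : 0 ≤ c := by positivity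
  let U : Ω → ℝ := fun ω => Λ * (1 + 7 / 4 * (1 + c * (5 * ‖X ω - xs‖ ^ 2
    + (V (i t ω) + |B|) / (8 * p.μ ^ 2) + 6 * |Bt| / p.μ)))
  have hUint : Integrable U Pr := by
    refine Integrable.const_mul ((integrable_const _).add (Integrable.const_mul
      ((integrable_const _).add (Integrable.const_mul ?_ _)) _)) _
    exact (((hDint.const_mul 5).add ((hVint.add (integrable_const _)).div_const _))).add
      (integrable_const _)
  have hUle : ∫ ω, U ω ∂Pr ≤ innerLengthConst r B σ G Bt p.ν p.Lg Bx p.μ * Λ := by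
    have hsplit : ∀ ω, U ω = 35 / 4 * Λ * c * ‖X ω - xs‖ ^ 2
        + 7 / 32 * Λ * c / p.μ ^ 2 * V (i t ω) + Λ * (1 + 7 / 4 * (1 + c * (|B| / (8 * p.μ ^ 2)
        + 6 * |Bt| / p.μ))) := by
      intro ω
      simp only [U]
      field_simp
      ring
    have hmain : ∫ ω, U ω ∂Pr = 35 / 4 * Λ * c * ∫ ω, ‖X ω - xs‖ ^ 2 ∂Pr
        + 7 / 32 * Λ * c / p.μ ^ 2 * ∫ ω, V (i t ω) ∂Pr + Λ * (1 + 7 / 4 * (1 + c *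
        (|B| / (8 * p.μ ^ 2) + 6 * |Bt| / p.μ))) := by
      simp only [hsplit]
      have e1 := integral_add
        ((hDint.const_mul (35 / 4 * Λ * c)).add (hVint.const_mul (7 / 32 * Λ * c / p.μ ^ 2)))
        (integrable_const (μ := Pr) (Λ * (1 + 7 / 4 * (1 + c *
          (|B| / (8 * p.μ ^ 2) + 6 * |Bt| / p.μ)))))
      have e2 := integral_add (hDint.const_mul (35 / 4 * Λ * c))
        (hVint.const_mul (7 / 32 * Λ * c / p.μ ^ 2))
      simp only [Pi.add_apply] at e1
      rw [e2] at e1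
      simp only [integral_const_mul, integral_const, probReal_univ, one_smul] at e1
      exact e1
    rw [hmain]
    have h1 : 35 / 4 * Λ * c * ∫ ω, ‖X ω - xs‖ ^ 2 ∂Pr ≤ 35 / 4 * Λ * c *
        (Bx ^ 2 + |noiseLevel r B σ G Bt p.ν p.Lg| / (4 * p.μ ^ 2)) := by gcongr
    have h2 : 7 / 32 * Λ * c / p.μ ^ 2 * ∫ ω, V (i t ω) ∂Pr
        ≤ 7 / 32 * Λ * c / p.μ ^ 2 * σ ^ 2 := by gcongr
    refine (add_le_add_left (add_le_add h1 h2) _).trans (le_of_eq ?_)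
    rw [innerLengthConst, slaterDistBound, ← hc]
    field_simp
    ring
  have hpt : ∀ ω, (innerLength Q p xt x₁ (fun s => i s ω) (fun s => j s ω) t : ℝ) ≤ U ω := by
    intro ω
    have h1 := H.norm_gradStep_sub_sq_le t (i t ω) (X ω) H.norm_xt_sub_sq_le
    rw [innerLength, Params.τ]
    refine (Nat.ceil_lt_add_one (by positivity)).le.trans ?_
    rw [← hc]
    change 1 / 2 * _ * (1 + c * ‖gradStep Q p t (i t ω) (X ω) - xt‖ ^ 2) + 1 ≤ _
    have h2 : 1 / 2 * Real.log ((t + 32) * (1 + p.κ)) *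
        (1 + c * ‖gradStep Q p t (i t ω) (X ω) - xt‖ ^ 2)
        ≤ 1 / 2 * (7 / 2 * Λ) * (1 + c * (5 * ‖X ω - xs‖ ^ 2
          + (V (i t ω) + |B|) / (8 * p.μ ^ 2) + 6 * |Bt| / p.μ)) := by gcongr
    -- The 1 lost to the ceiling is absorbed by 1 ≤ Λ.
    refine (add_le_add h2 hΛ1).trans (le_of_eq ?_)
    simp only [U]
    ring
  have hzm : Measurable fun ω => gradStep Q p t (i t ω) (X ω) :=
    Measurable.comp (g := fun q : E d × Ξ => gradStep Q p t q.2 q.1)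
      (f := fun ω => (X ω, i t ω)) (H.measurable_gradStep t) (hXm.prodMk (hS.measurable_i t))
  have hm : Measurable fun ω =>
      (innerLength Q p xt x₁ (fun s => i s ω) (fun s => j s ω) t : ℝ) :=
    Measurable.comp (g := fun n : ℕ => (n : ℝ)) (f := fun ω => p.τ xt t _)
      (measurable_of_countable _) ((measurable_τ p xt t).comp hzm)
  have hInt : Integrable (fun ω =>
      (innerLength Q p xt x₁ (fun s => i s ω) (fun s => j s ω) t : ℝ)) Pr := by
    refine hUint.mono' hm.aestronglyMeasurable (Filter.Eventually.of_forall fun ω => ?_)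
    rw [Real.norm_of_nonneg (Nat.cast_nonneg _)]
    exact hpt ω
  exact ⟨hInt, (integral_mono hInt hUint hpt).trans hUle⟩

/-- The expected number of oracle calls. -/
theorem integral_sfoCalls_le (H : Assumptions Q P p r B σ G Bt xs xt)
    (hS : IsSampling P Pr i j) {x₁ : E d} (hx₁ : ‖x₁ - xs‖ ≤ Bx) {T : ℕ} (hT : 1 ≤ T)
    (hC : 0 ≤ innerLengthConst r B σ G Bt p.ν p.Lg Bx p.μ) :
    Integrable (fun ω => (sfoCalls Q p xt x₁ (fun s => i s ω) (fun s => j s ω) T : ℝ)) Pr ∧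
    ∫ ω, (sfoCalls Q p xt x₁ (fun s => i s ω) (fun s => j s ω) T : ℝ) ∂Pr
      ≤ innerLengthConst r B σ G Bt p.ν p.Lg Bx p.μ * (T * Real.log ((1 + p.κ) * T)) := by
  simp only [sfoCalls, Nat.cast_sum]
  have hInt : ∀ t ∈ Finset.Ico 1 T, Integrable (fun ω =>
      (innerLength Q p xt x₁ (fun s => i s ω) (fun s => j s ω) t : ℝ)) Pr :=
    fun t ht => (H.integral_innerLength_le hS hx₁ (Finset.mem_Ico.1 ht).1).1
  refine ⟨integrable_finsetSum _ hInt, ?_⟩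
  rw [integral_finsetSum _ hInt]
  have hT' : (1 : ℝ) ≤ T := by exact_mod_cast hT
  have hκ := H.κ_ge
  have hlog : 0 ≤ Real.log ((1 + p.κ) * T) := Real.log_nonneg (by nlinarith)
  calc _ ≤ ∑ t ∈ Finset.Ico 1 T, innerLengthConst r B σ G Bt p.ν p.Lg Bx p.μ *
        Real.log ((1 + p.κ) * T) := by
        refine Finset.sum_le_sum fun t ht => ?_
        obtain ⟨h1, h2⟩ := Finset.mem_Ico.1 ht
        refine (H.integral_innerLength_le hS hx₁ h1).2.trans ?_
        have h3 : (t : ℝ) + 1 ≤ T := by exact_mod_cast h2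
        gcongr
    _ = (T - 1 : ℕ) * (innerLengthConst r B σ G Bt p.ν p.Lg Bx p.μ *
        Real.log ((1 + p.κ) * T)) := by
        rw [Finset.sum_const, Nat.card_Ico, nsmul_eq_mul]
    _ ≤ T * (innerLengthConst r B σ G Bt p.ν p.Lg Bx p.μ * Real.log ((1 + p.κ) * T)) := by
        gcongr
        exact Nat.sub_le _ _
    _ = _ := by ring

end Assumptions

/-! ### From the rate to the oracle complexity. -/

/-- With `T` of the order `1 / (μ² ε) + κ / √ε` the rate bound is at most `ε`. -/
theorem rate_le_of_ceil {C μ κ ε : ℝ} (hC : 1 ≤ C) (hμ : 0 < μ) (hκ : 0 < κ) (hε : 0 < ε) {T : ℕ}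
    (hT : 2 * C * (1 / (μ ^ 2 * ε) + κ / √ε) ≤ T) :
    C * (1 / (μ ^ 2 * T) + κ ^ 2 / (T : ℝ) ^ 2) ≤ ε := by
  have hs : 0 < √ε := Real.sqrt_pos.2 hε
  have h1 : 0 < 1 / (μ ^ 2 * ε) := by positivity
  have h2 : 0 < κ / √ε := by positivity
  have hT0 : (0 : ℝ) < T := lt_of_lt_of_le (by positivity) hT
  have h3 : C * (1 / (μ ^ 2 * T)) ≤ ε / 2 := by
    have h4 : 2 * C * (1 / (μ ^ 2 * ε)) ≤ T := by
      refine le_trans ?_ hT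
      gcongr
      linarith
    rw [mul_one_div, div_le_iff₀ (by positivity)] at h4 ⊢
    linarith
  have h5 : C * (κ ^ 2 / (T : ℝ) ^ 2) ≤ ε / 2 := by
    have h4 : 2 * C * (κ / √ε) ≤ T := by
      refine le_trans ?_ hT
      gcongr
      linarith
    have h6 : (2 * C * (κ / √ε)) ^ 2 ≤ (T : ℝ) ^ 2 := by gcongr
    have h7 : (2 * C * (κ / √ε)) ^ 2 = 4 * C ^ 2 * κ ^ 2 / ε := by
      rw [mul_pow, div_pow, Real.sq_sqrt hε.le]; ring
    rw [h7, div_le_iff₀ hε] at h6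
    rw [← mul_div_assoc, div_le_iff₀ (by positivity)]
    have h8 : C * κ ^ 2 ≤ C ^ 2 * κ ^ 2 := by
      gcongr
      nlinarith
    have h9 : 0 ≤ C ^ 2 * κ ^ 2 := by positivity
    linarith
  linarith

/-- The number of outer steps and its logarithm in terms of the target accuracy. -/
theorem ceil_mul_log_le {c μ κ ε : ℝ} (hc : 0 < c) (hμ : 0 < μ) (hκ : 1 ≤ κ) (hε : 0 < ε)
    (hε2 : ε ≤ 1 / 2) {T : ℕ} (hT1 : 1 ≤ T) (hT : T = ⌈c * (1 / (μ ^ 2 * ε) + κ / √ε)⌉₊) {A : ℝ}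
    (hA : A = c * (1 / μ ^ 2 + 1) + 1) :
    T * Real.log ((1 + κ) * T)
      ≤ A * (A + 2) * ((1 / ε + κ / √ε) * (Real.log (1 / ε) + Real.log (1 + κ))) := by
  have hs : 0 < √ε := Real.sqrt_pos.2 hε
  have hA1 : 1 ≤ A := by
    have : 0 ≤ c * (1 / μ ^ 2 + 1) := by positivity
    linarith
  have hTpos : (1 : ℝ) ≤ T := by exact_mod_cast hT1
  have hinv : 2 ≤ 1 / ε := by
    rw [le_div_iff₀ hε]; linarith
  have hκs : 0 ≤ κ / √ε := by positivity
  have h1 : (T : ℝ) ≤ A * (1 / ε + κ / √ε) := by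
    have h2 : (T : ℝ) < c * (1 / (μ ^ 2 * ε) + κ / √ε) + 1 := by
      rw [hT]; exact Nat.ceil_lt_add_one (by positivity)
    have h3 : 1 / (μ ^ 2 * ε) = 1 / μ ^ 2 * (1 / ε) := by field_simp
    have h4 : 0 ≤ c * (1 / μ ^ 2 * (κ / √ε)) := by positivity
    have h5 : 0 ≤ c * (1 / ε) := by positivity
    rw [h3] at h2
    rw [hA]
    linarith
  have h2 : κ / √ε ≤ κ / ε := by
    gcongr
    rw [Real.le_sqrt hε.le hε.le]
    nlinarith
  have h3 : (1 + κ) * T ≤ A * (1 + κ) ^ 2 * (1 / ε) := by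
    calc (1 + κ) * T ≤ (1 + κ) * (A * (1 / ε + κ / ε)) := by
          gcongr
          refine h1.trans ?_
          gcongr
      _ = _ := by ring
  have hlogε : Real.log 2 ≤ Real.log (1 / ε) := Real.log_le_log (by norm_num) hinv
  have hlogκ : Real.log 2 ≤ Real.log (1 + κ) := Real.log_le_log (by norm_num) (by linarith)
  have hlog2 := Real.log_two_gt_d9
  -- The constant log A ≤ A - 1 is absorbed because the two logarithms on the right add up to at
  -- least 2 log 2 > 1.
  have h4 : Real.log ((1 + κ) * T) ≤ (A + 2) * (Real.log (1 / ε) + Real.log (1 + κ)) := by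
    have h5 := Real.log_le_log (by positivity) h3
    rw [Real.log_mul (x := A * (1 + κ) ^ 2) (by positivity) (by positivity),
      Real.log_mul (x := A) (by positivity) (by positivity), Real.log_pow] at h5
    have h6 := Real.log_le_sub_one_of_pos (by linarith : 0 < A)
    push_cast at h5
    nlinarith
  calc T * Real.log ((1 + κ) * T)
      ≤ (A * (1 / ε + κ / √ε)) * ((A + 2) * (Real.log (1 / ε) + Real.log (1 + κ))) := by
        gcongr
        exact Real.log_nonneg (by nlinarith)
    _ = _ := by ring

end NHPS

/-- Nested hinge-proximal SGD. The constants `C`, `C'` depend only on the bounds in the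
assumptions, `C''` in addition on `μ`; none depends on `m`, `d`, `Lf` or the problem. -/
theorem mainTheorem3 (r B σ G Bt ν Lg Bx : ℝ) (hr : 0 < r) (hν : 0 < ν) (hLg : 0 ≤ Lg) :
    ∃ C > (0 : ℝ), ∃ C' > (0 : ℝ), ∀ μ : ℝ, 0 < μ → ∃ C'' > (0 : ℝ), ∀ Lf : ℝ, μ ≤ Lf →
    ∀ p : NHPS.Params, p = ⟨μ, Lf, Lg, ν⟩ →
    ∀ (d m : ℕ) (Ξ : Type*) [MeasurableSpace Ξ] (P : Measure Ξ) [IsProbabilityMeasure P]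
      (Q : NHPS.Problem d m Ξ) (xs xt : NHPS.E d),
    Q.IsStochastic P →
    Q.ConvexSmooth p →
    Q.IsSolution P xs →
    Q.Slater P ν Bt xs xt →
    StrongConvexOn Set.univ μ (Q.mean P) →
    Q.BoundedVariance P σ xs →
    Q.BoundedGradients P G B xs →
    Q.LinearlyRegular r →
    ∀ (Ω : Type*) [MeasurableSpace Ω] (Pr : Measure Ω) [IsProbabilityMeasure Pr]
      (i : ℕ → Ω → Ξ) (j : ℕ → Ω → Fin m), NHPS.IsSampling P Pr i j →
    ∀ x₁ : NHPS.E d, ‖x₁ - xs‖ ≤ Bx →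
    ∀ (x : ℕ → Ω → NHPS.E d) (τ N : ℕ → Ω → ℕ),
    (∀ t ω, x t ω = NHPS.iter Q p xt x₁ (fun s => i s ω) (fun s => j s ω) t) →
    (∀ t ω, τ t ω = NHPS.innerLength Q p xt x₁ (fun s => i s ω) (fun s => j s ω) t) →
    (∀ T ω, N T ω = NHPS.sfoCalls Q p xt x₁ (fun s => i s ω) (fun s => j s ω) T) →
    -- convergence rate
    (∀ T : ℕ, 1 ≤ T →
      Integrable (fun ω => ‖x T ω - xs‖ ^ 2) Pr ∧
      ∫ ω, ‖x T ω - xs‖ ^ 2 ∂Pr ≤ C * (1 / (μ ^ 2 * T) + p.κ ^ 2 / (T : ℝ) ^ 2)) ∧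
    -- expected inner loop length
    (∀ t : ℕ, 1 ≤ t →
      Integrable (fun ω => (τ t ω : ℝ)) Pr ∧
      ∫ ω, (τ t ω : ℝ) ∂Pr ≤ C'' * Real.log ((1 + p.κ) * (t + 1))) ∧
    -- expected oracle complexity
    (∀ ε : ℝ, 0 < ε → ε ≤ 1 / 2 →
      ∀ T : ℕ, T = ⌈C' * (1 / (μ ^ 2 * ε) + p.κ / √ε)⌉₊ →
        1 ≤ T ∧
        ∫ ω, ‖x T ω - xs‖ ^ 2 ∂Pr ≤ ε ∧
        Integrable (fun ω => (N T ω : ℝ)) Pr ∧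
        ∫ ω, (N T ω : ℝ) ∂Pr
          ≤ C'' * ((1 / ε + p.κ / √ε) * (Real.log (1 / ε) + Real.log (1 + p.κ))) ∧
        (ε ≤ 1 / (1 + p.κ) →
          ∫ ω, (N T ω : ℝ) ∂Pr ≤ C'' * ((1 / ε + p.κ / √ε) * Real.log (1 / ε)))) := by
  -- Neither `noiseLevel` nor `Bx` involves μ or L_f, so this constant can be fixed before both.
  set C : ℝ := 1024 * Bx ^ 2 + 16 * |NHPS.noiseLevel r B σ G Bt ν Lg| + 1 with hC
  have hC1 : 1 ≤ C := by
    have : 0 ≤ 1024 * Bx ^ 2 + 16 * |NHPS.noiseLevel r B σ G Bt ν Lg| := by positivity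
    linarith
  refine ⟨C, by linarith, 2 * C, by linarith, fun μ hμ => ?_⟩
  set A : ℝ := 2 * C * (1 / μ ^ 2 + 1) + 1 with hA
  have hA1 : 1 ≤ A := by
    have : 0 ≤ 2 * C * (1 / μ ^ 2 + 1) := by positivity
    linarith
  set Cτ : ℝ := NHPS.innerLengthConst r B σ G Bt ν Lg Bx μ with hCτ
  have hCτ1 : 1 ≤ Cτ := by
    rw [hCτ, NHPS.innerLengthConst, NHPS.slaterDistBound]
    refine le_add_of_nonneg_right ?_
    positivity
  have hAA : 1 ≤ A * (A + 2) := by nlinarith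
  -- The factor 2 serves the last claim, where log(1 + κ) ≤ log(1/ε) at most doubles the logarithmic
  -- factor.
  refine ⟨2 * (Cτ * (A * (A + 2))), by positivity, ?_⟩
  rintro Lf hLf p rfl d m Ξ _ P _ Q xs xt hstoch hsmooth hsol hslater hstrong hvar hgrads hreg Ω _
    Pr _ i j hS x₁ hx₁ x τ N hx hτ hN
  -- Positivity of m is not assumed: a draw `j 0 ω` is itself an element of `Fin m`.
  have hm : 0 < m := by
    obtain ⟨ω⟩ := nonempty_of_isProbabilityMeasure Pr
    exact Fin.pos (j 0 ω)
  have H : NHPS.Assumptions Q P ⟨μ, Lf, Lg, ν⟩ r B σ G Bt xs xt :=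
    ⟨hr, hν, hLg, hμ, hLf, hm, hstoch, hsmooth, hsol, hslater, hstrong, hvar, hgrads, hreg⟩
  simp only [hx, hτ, hN]
  set κ := (⟨μ, Lf, Lg, ν⟩ : NHPS.Params).κ
  have hκ : 1 ≤ κ := H.κ_ge
  have hrate := fun T (hT : 1 ≤ T) => H.integral_error_le hS hx₁ hT
  refine ⟨fun T hT => ⟨H.integrable_error hS x₁ hT, hrate T hT⟩, fun t ht => ?_, ?_⟩
  · obtain ⟨h1, h2⟩ := H.integral_innerLength_le hS hx₁ ht
    refine ⟨h1, h2.trans ?_⟩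
    have h3 : 0 ≤ Real.log ((1 + κ) * (t + 1)) :=
      zero_le_one.trans (NHPS.one_le_log_mul ht hκ)
    refine mul_le_mul_of_nonneg_right ?_ h3
    change Cτ ≤ _
    nlinarith
  · intro ε hε hε2 T hT
    have hT1 : 1 ≤ T := by
      rw [hT, Nat.one_le_ceil_iff]
      positivity
    have hacc := (hrate T hT1).trans
      (NHPS.rate_le_of_ceil hC1 hμ (by linarith) hε (hT ▸ Nat.le_ceil _))
    obtain ⟨h1, h2⟩ := H.integral_sfoCalls_le hS hx₁ hT1 (zero_le_one.trans hCτ1)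
    have h3 := NHPS.ceil_mul_log_le (by positivity) hμ hκ hε hε2 hT1 hT hA
    have hinv : 2 ≤ 1 / ε := by
      rw [le_div_iff₀ hε]; linarith
    have hlogε : 0 ≤ Real.log (1 / ε) := Real.log_nonneg (by linarith)
    have hlogκ : 0 ≤ Real.log (1 + κ) := Real.log_nonneg (by linarith)
    set W := (1 / ε + κ / √ε) * (Real.log (1 / ε) + Real.log (1 + κ)) with hW
    have hW0 : 0 ≤ W := by positivity
    have h4 := h2.trans (mul_le_mul_of_nonneg_left h3 (zero_le_one.trans hCτ1))
    change _ ≤ Cτ * (A * (A + 2) * W) at h4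
    have hP : 0 ≤ Cτ * (A * (A + 2)) := by positivity
    refine ⟨hT1, hacc, h1, h4.trans ?_, fun hεκ => h4.trans ?_⟩
    · have := mul_nonneg hP hW0
      linarith
    · have h5 : Real.log (1 + κ) ≤ Real.log (1 / ε) := by
        refine Real.log_le_log (by linarith) ?_
        rw [le_div_iff₀ (by linarith)] at hεκ ⊢
        linarith
      have h6 : W ≤ 2 * ((1 / ε + κ / √ε) * Real.log (1 / ε)) := by
        calc W ≤ (1 / ε + κ / √ε) * (Real.log (1 / ε) + Real.log (1 / ε)) := by
              rw [hW]; gcongr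
          _ = _ := by ring
      have h7 := mul_le_mul_of_nonneg_left h6 hP
      linarith
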